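/- Consider walks in the square lattice $\mathbb Z^2$ that start at the origin and use steps $\mathsf E=(1,0)$, $\mathsf N=(0,1)$, $\mathsf W=(-1,0)$, $\mathsf S=(0,-1)$, with no confinement; such a walk is a loop if it ends at the origin. Let $\mathcal W_{0,0}(a,s,t)\in\mathbb Z[a][[s,t]]$ be the generating function of loops, where $s$ counts horizontal steps, $t$ counts vertical steps, and $a$ counts $\mathsf{NW}$ and $\mathsf{ES}$ corners (that is, occurrences of an $\mathsf N$ step immediately followed by a $\mathsf W$ step, or of an $\mathsf E$ step immediately followed by an $\mathsf S$ step). Then $\mathcal W_{0,0}(a,s,t)$ is $(a+1)$-positive: for all $i,j\ge 0$, the coefficient of $s^it^j$ is a polynomial in $(a+1)$ with non-negative integer coefficients. Moreover, $$\mathcal W_{0,0}(1,s,t)=\sum_{i,j\ge 0}s^{2i}t^{2j}\binom{2i+2j}{2i}\binom{2i}{i}\binom{2j}{j},$$ $$\mathcal W_{0,0}(-1,s,t)=\sum_{i,j\ge 0}s^{2i}t^{2j}\binom{i+j}{i}\binom{2i}{i}\binom{2j}{j},$$ and, when $s=t=u$, $$\mathcal W_{0,0}(1,u,u)=\sum_{n\ge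 0}u^{2n}\binom{2n}{n}^2.$$ -/

import Mathlib

open scoped Polynomial MvPowerSeries.WithPiTopology

namespace SquareWalk

/-- The four unit steps of the square lattice. -/
inductive Step
  | east
  | north
  | west
  | south
  deriving DecidableEq

namespace Step

instance : Fintype Step where
  elems := {east, north, west, south}
  complete := by intro x; cases x <;> simp

/-- The displacement of a step: `E = (1,0)`, `N = (0,1)`, `W = (-1,0)`, `S = (0,-1)`. -/
def vec : Step → ℤ × ℤ
  | east => (1, 0)
  | north => (0, 1)
  | west => (-1, 0)
  | south => (0, -1)

/-- A step is horizontal if it is an `E` or a `W` step. -/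
def IsHorizontal (x : Step) : Prop := x = east ∨ x = west

/-- A step is vertical if it is an `N` or an `S` step. -/
def IsVertical (x : Step) : Prop := x = north ∨ x = south

instance : DecidablePred IsHorizontal := fun x =>
  inferInstanceAs (Decidable (x = east ∨ x = west))

instance : DecidablePred IsVertical := fun x =>
  inferInstanceAs (Decidable (x = north ∨ x = south))

end Step

/-- A square lattice walk starting at the origin is the word of its steps;
this is its endpoint. -/
def endpoint (w : List Step) : ℤ × ℤ := (w.map Step.vec).sum

/-- Number of horizontal steps. -/
def numHorizontal (w : List Step) : ℕ := w.countP (fun x => decide x.IsHorizontal)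

/-- Number of vertical steps. -/
def numVertical (w : List Step) : ℕ := w.countP (fun x => decide x.IsVertical)

/-- Number of `NW` and `ES` corners, that is, of pairs of consecutive steps
of the form `N, W` or `E, S`. -/
def numCorners : List Step → ℕ
  | [] => 0
  | [_] => 0
  | x :: y :: w =>
      (if (x = Step.north ∧ y = Step.west) ∨ (x = Step.east ∧ y = Step.south) then 1 else 0)
        + numCorners (y :: w)

/-- The set of (unconfined) walks with `i` horizontal steps, `j` vertical steps and endpoint `p`,
encoded by their step functions `Fin (i + j) → Step`. -/
def walks (i j : ℕ) (p : ℤ × ℤ) : Finset (Fin (i + j) → Step) :=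
  Finset.univ.filter fun w =>
    numHorizontal (List.ofFn w) = i ∧ numVertical (List.ofFn w) = j ∧ endpoint (List.ofFn w) = p

/-- The polynomial in `a` counting these walks by the number of `NW` and `ES` corners. -/
noncomputable def cornerPoly (i j : ℕ) (p : ℤ × ℤ) : ℤ[X] :=
  ∑ w ∈ walks i j p, Polynomial.X ^ numCorners (List.ofFn w)

/-- The generating function, in `ℤ[a][[s,t]]`, of the walks with endpoint `p`; the variable
of index `0` is `s` (horizontal steps) and that of index `1` is `t` (vertical steps). -/
noncomputable def walkSeries (p : ℤ × ℤ) : MvPowerSeries (Fin 2) ℤ[X] :=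
  fun e => cornerPoly (e 0) (e 1) p

/-- The generating function of loops, i.e. of walks that end at the origin. -/
noncomputable def loopSeries : MvPowerSeries (Fin 2) ℤ[X] := walkSeries (0, 0)

/-- A series in `ℤ[a][[s,t]]` is `(a+1)`-positive if each of its coefficients is of the form
`P (a + 1)` where the polynomial `P` has coefficients in `ℕ`. -/
def IsAddOnePositive (F : MvPowerSeries (Fin 2) ℤ[X]) : Prop :=
  ∀ e : Fin 2 →₀ ℕ, ∃ P : Polynomial ℕ,
    MvPowerSeries.coeff e F = (P.map (Nat.castRingHom ℤ)).comp (Polynomial.X + 1)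

/-- Specialization of the variable `a` to the integer `c`. -/
noncomputable def specialize (c : ℤ) (F : MvPowerSeries (Fin 2) ℤ[X]) : MvPowerSeries (Fin 2) ℤ :=
  MvPowerSeries.map (Polynomial.evalRingHom c) F

/-- The substitution `s = t = u`. -/
noncomputable def diagonal (F : MvPowerSeries (Fin 2) ℤ) : PowerSeries ℤ :=
  MvPowerSeries.subst (fun _ : Fin 2 => (PowerSeries.X : PowerSeries ℤ)) F

end SquareWalk

/-! Put `b = a + 1`, `x = s²`, `y = t²`. Let σ be the sum of the four step variables and τ = NW +
ES. A corner contributes `a = 1 + (a - 1)`, and two corners never overlap, so words weighted by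
corners have generating function 1/(1 - σT - (a-1)τT²) (`wordSum_add_two`, `wordSum_eq_sum`). Loops
are its balanced part: keep the monomials (EW)^i(NS)^j and send EW to x, NS to y. Writing σ = u + d
with u = E + N, d = W + S, only the middle term of σ^(2p) survives, and ud = EW + NS + τ. Hence the
balanced part of σ^(2p)τ^k is an explicit sum in x + y and xy (`balancedPart_sum_pow_mul`).

A terminating Gegenbauer-type sum (`sum_legendre`) turns powers of a - 1 = b - 2 into products of
powers of b² and -(2-b)². Summing over the power of x + y then yields a double series in the
functions (1 - 4(x+y))^(-1/2-k), still with signs (`hasSum_loopPoly_halfPow`).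

Positivity comes from `hasSum_quadratic_transformation`, which identifies such a double series with
the average of (1 - κU - (1-κ)W)^(-1/2) over the arcsine law in κ. Let ω = xy/((1-4x)(1-4y)). The
matching values are U = 4b²ω + 16bω + 2z and W = 16ω + 4b²ω + z, where z is the root with zero
constant term of a quadratic z = u + vz + z² whose u and v have non-negative coefficients in x, y,
b. The loop series is (1-4x)^(-1/2)(1-4y)^(-1/2) times this average
(`hasSum_loopPoly_arcsineSeries`). Since z is a Catalan-type series (`exists_quadratic_root`), every
ingredient has non-negative coefficients, and the coefficient of b^k x^i y^j is the coefficient of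
(a+1)^k in the loop polynomial (`coeff_comp_loopPoly`).

At a = 1 the term in τ disappears, and Vandermonde's identity evaluates the balanced part of σ^(2n);
summing over i + j = n gives the diagonal. At a = -1, that is b = 0, one may take z = 0, so U = 0
and W = 16ω; expanding in ω and applying Vandermonde again gives the second formula. -/

namespace SquareWalk

/-! ### Arcsine moments and terminating hypergeometric sums. -/

/-- The rising factorial `(1/2)(3/2)⋯(n - 1/2)`. -/
def halfRising (n : ℕ) : ℚ := ∏ i ∈ Finset.range n, ((i : ℚ) + 1 / 2)

@[simp] lemma halfRising_zero : halfRising 0 = 1 := by simp [halfRising]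

lemma halfRising_succ (n : ℕ) : halfRising (n + 1) = halfRising n * (n + 1 / 2) := by
  simp [halfRising, Finset.prod_range_succ]

lemma halfRising_pos (n : ℕ) : 0 < halfRising n :=
  Finset.prod_pos fun i _ => by positivity

lemma halfRising_ne_zero (n : ℕ) : halfRising n ≠ 0 := (halfRising_pos n).ne'

lemma four_pow_mul_halfRising (n : ℕ) :
    4 ^ n * halfRising n * n.factorial = (2 * n).factorial := by
  induction n with
  | zero => simp
  | succ n ih =>
    rw [halfRising_succ, show 2 * (n + 1) = 2 * n + 1 + 1 by ring, Nat.factorial_succ (2 * n + 1),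
      Nat.factorial_succ (2 * n), Nat.factorial_succ n]
    push_cast
    rw [← ih]
    ring

/-- The moments `∫ κ^p (1 - κ)^q` of the arcsine distribution. -/
def arcsineMoment (p q : ℕ) : ℚ := halfRising p * halfRising q / (p + q).factorial

/-- Insert 1 = κ + (1 - κ) under the integral. -/
lemma arcsineMoment_eq_add (p q : ℕ) :
    arcsineMoment p q = arcsineMoment (p + 1) q + arcsineMoment p (q + 1) := by
  have h : ((p + q).factorial : ℚ) ≠ 0 := by positivity
  have h' : ((p : ℚ) + q + 1) ≠ 0 := by positivity
  simp only [arcsineMoment]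
  rw [show p + 1 + q = p + q + 1 by ring, show p + (q + 1) = p + q + 1 by ring,
    Nat.factorial_succ, halfRising_succ, halfRising_succ]
  push_cast
  field_simp
  ring

/-- Pascal's rule, in the shape that drives the inductions on binomial sums below. -/
lemma sum_choose_mul_succ {M : Type*} [CommRing M] (f : ℕ → ℕ → M) (s : ℕ) :
    ∑ g ∈ Finset.range (s + 2), ((s + 1).choose g : M) * f g (s + 1 - g) =
      ∑ g ∈ Finset.range (s + 1), (s.choose g : M) * f (g + 1) (s - g) +
      ∑ g ∈ Finset.range (s + 1), (s.choose g : M) * f g (s - g + 1) := by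
  rw [Finset.sum_range_succ']
  have h2 : ∑ g ∈ Finset.range (s + 1), (s.choose g : M) * f g (s - g + 1)
      = ∑ g ∈ Finset.range (s + 1), (s.choose (g + 1) : M) * f (g + 1) (s - g) + f 0 (s + 1) := by
    have e : ∑ g ∈ Finset.range (s + 2), (s.choose g : M) * f g (s + 1 - g)
        = ∑ g ∈ Finset.range (s + 1), (s.choose g : M) * f g (s - g + 1) := by
      rw [Finset.sum_range_succ]
      simp only [Nat.choose_succ_self, Nat.cast_zero, zero_mul, add_zero]
      refine Finset.sum_congr rfl fun g hg => ?_
      rw [Nat.sub_add_comm (Nat.lt_succ_iff.mp (Finset.mem_range.mp hg))]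
    rw [← e, Finset.sum_range_succ']
    simp
  rw [h2, ← add_assoc, ← Finset.sum_add_distrib]
  simp only [Nat.choose_succ_succ, Nat.cast_add, add_mul, Nat.choose_zero_right, Nat.cast_one,
    one_mul, Nat.sub_zero, Nat.succ_eq_add_one, Nat.add_sub_add_right]

/-- Expansion of (κ + (1 - κ))^s = 1 under the integral. -/
lemma sum_choose_mul_arcsineMoment (s p q : ℕ) :
    ∑ g ∈ Finset.range (s + 1), (s.choose g : ℚ) * arcsineMoment (p + g) (q + (s - g)) =
      arcsineMoment p q := by
  induction s generalizing p q with
  | zero => simp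
  | succ s ih =>
    rw [sum_choose_mul_succ fun g h => arcsineMoment (p + g) (q + h), arcsineMoment_eq_add p q,
      ← ih (p + 1) q, ← ih p (q + 1)]
    congr 1 <;> refine Finset.sum_congr rfl fun g _ => ?_ <;> congr 2 <;> ring

/-- Expansion of (1 - κ)^q in powers of κ under the integral. -/
lemma sum_alternating_arcsineMoment (q i r : ℕ) :
    ∑ j ∈ Finset.range (q + 1), (q.choose j : ℚ) * ((-1) ^ j * arcsineMoment (i + j) r) =
      arcsineMoment i (r + q) := by
  induction q generalizing i r with
  | zero => simp
  | succ q ih =>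
    rw [sum_choose_mul_succ fun g _ => (-1) ^ g * arcsineMoment (i + g) r, ih i r,
      show r + (q + 1) = r + q + 1 by ring, eq_sub_of_add_eq' (arcsineMoment_eq_add i (r + q)).symm,
      ← ih (i + 1) r, sub_eq_neg_add, ← Finset.sum_neg_distrib]
    congr 1
    refine Finset.sum_congr rfl fun g _ => ?_
    rw [show i + (g + 1) = i + 1 + g by ring]
    ring

/-- A p-th finite difference. Keeping `m` and `q` independent lets the induction shift both at once:
each difference step contributes one linear factor. -/
lemma sum_alternating_halfRising_div (p m q : ℕ) :
    ∑ i ∈ Finset.range (p + 1),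
      (p.choose i : ℚ) * ((-1) ^ (p - i) * (halfRising (m + i) / (q + i).factorial)) =
      halfRising m * (∏ t ∈ Finset.range p, ((m : ℚ) - 1 / 2 - q - t)) / (q + p).factorial := by
  induction p generalizing m q with
  | zero => simp
  | succ p ih =>
    rw [sum_choose_mul_succ fun g h => (-1) ^ h * (halfRising (m + g) / (q + g).factorial)]
    have h1 := ih (m + 1) (q + 1)
    have h2 := ih m q
    have e1 : ∑ g ∈ Finset.range (p + 1), (p.choose g : ℚ) *
        ((-1) ^ (p - g) * (halfRising (m + (g + 1)) / (q + (g + 1)).factorial)) =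
        halfRising (m + 1) * (∏ t ∈ Finset.range p, ((m : ℚ) - 1 / 2 - q - t))
          / (q + 1 + p).factorial := by
      rw [show (∏ t ∈ Finset.range p, ((m : ℚ) - 1 / 2 - q - t)) =
        ∏ t ∈ Finset.range p, (((m + 1 : ℕ) : ℚ) - 1 / 2 - (q + 1 : ℕ) - t) from
        Finset.prod_congr rfl fun t _ => by push_cast; ring, ← h1]
      refine Finset.sum_congr rfl fun g _ => ?_
      rw [show m + (g + 1) = m + 1 + g by ring, show q + (g + 1) = q + 1 + g by ring]
    have e2 : ∑ g ∈ Finset.range (p + 1), (p.choose g : ℚ) *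
        ((-1) ^ (p - g + 1) * (halfRising (m + g) / (q + g).factorial)) =
        -(halfRising m * (∏ t ∈ Finset.range p, ((m : ℚ) - 1 / 2 - q - t)) / (q + p).factorial) := by
      rw [← h2, ← Finset.sum_neg_distrib]
      exact Finset.sum_congr rfl fun g _ => by ring
    rw [e1, e2, Finset.prod_range_succ, halfRising_succ, show q + 1 + p = q + p + 1 by ring,
      show q + (p + 1) = q + p + 1 by ring, Nat.factorial_succ]
    have h : ((q + p).factorial : ℚ) ≠ 0 := by positivity
    have h' : ((q : ℚ) + p + 1) ≠ 0 := by positivity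
    push_cast
    field_simp
    ring

lemma prod_range_sub_half (p : ℕ) :
    ∏ t ∈ Finset.range p, ((p : ℚ) - 1 / 2 - t) = halfRising p := by
  rw [halfRising, ← Finset.prod_range_reflect]
  refine Finset.prod_congr rfl fun t ht => ?_
  have : t + 1 ≤ p := Finset.mem_range.mp ht
  rw [show p - 1 - t = p - (t + 1) by omega, Nat.cast_sub this]
  push_cast
  ring

/-- A terminating Chu–Vandermonde sum. -/
lemma sum_alternating_halfRising (p q : ℕ) :
    ∑ i ∈ Finset.range (p + 1),
      (p.choose i : ℚ) * ((-1) ^ (p - i) * (halfRising (p + q + i) / (q + i).factorial)) =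
      halfRising (p + q) * halfRising p / (p + q).factorial := by
  rw [sum_alternating_halfRising_div, add_comm q p, ← prod_range_sub_half p]
  congr 2
  refine Finset.prod_congr rfl fun t _ => ?_
  push_cast
  ring

/-- The coefficient identity behind `hasSum_quadratic_transformation`. -/
lemma sum_sum_halfRising (p q : ℕ) :
    ∑ i ∈ Finset.range (p + 1), ∑ j ∈ Finset.range (q + 1),
      ((2 * (i + j)).choose (i + j) : ℚ) * (-1 / 4) ^ j * (-1) ^ (p - i) * halfRising (p + q + i) /
        (halfRising (p + q) * (2 * i).factorial * j.factorial * (p - i).factorial *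
          (q - j).factorial) =
      halfRising p * halfRising q / (p.factorial * q.factorial * (p + q).factorial) := by
  -- A central binomial coefficient is a power of 4 times a moment of κ, so the sum over `j` is the
  -- moment of κ^i(1 - κ)^q; what remains in `i` is the Chu–Vandermonde sum.
  have key : ∀ i ∈ Finset.range (p + 1), ∑ j ∈ Finset.range (q + 1),
      ((2 * (i + j)).choose (i + j) : ℚ) * (-1 / 4) ^ j * (-1) ^ (p - i) * halfRising (p + q + i) /
        (halfRising (p + q) * (2 * i).factorial * j.factorial * (p - i).factorial *
          (q - j).factorial) =
      halfRising q / (halfRising (p + q) * p.factorial * q.factorial) *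
      ((p.choose i : ℚ) * ((-1) ^ (p - i) * (halfRising (p + q + i) / (q + i).factorial))) := by
    intro i hi
    have hi' : i ≤ p := Nat.lt_succ_iff.mp (Finset.mem_range.mp hi)
    have hm := sum_alternating_arcsineMoment q i 0
    have hterm : ∀ j ∈ Finset.range (q + 1),
        ((2 * (i + j)).choose (i + j) : ℚ) * (-1 / 4) ^ j * (-1) ^ (p - i) *
          halfRising (p + q + i) / (halfRising (p + q) * (2 * i).factorial * j.factorial *
            (p - i).factorial * (q - j).factorial) =
        4 ^ i * (-1) ^ (p - i) * halfRising (p + q + i) /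
          (halfRising (p + q) * (2 * i).factorial * (p - i).factorial * q.factorial) *
          ((q.choose j : ℚ) * ((-1) ^ j * arcsineMoment (i + j) 0)) := by
      intro j hj
      have hj' : j ≤ q := Nat.lt_succ_iff.mp (Finset.mem_range.mp hj)
      have hc : ((2 * (i + j)).choose (i + j) : ℚ) =
          4 ^ (i + j) * arcsineMoment (i + j) 0 := by
        have h1 := four_pow_mul_halfRising (i + j)
        have h2 : ((2 * (i + j)).choose (i + j) : ℚ) = (2 * (i + j)).factorial /
            ((i + j).factorial * (i + j).factorial) := by
          rw [Nat.cast_choose ℚ (by omega), show 2 * (i + j) - (i + j) = i + j by omega]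
        have h3 : ((i + j).factorial : ℚ) ≠ 0 := by positivity
        rw [h2, ← h1, arcsineMoment, halfRising_zero]
        field_simp
        simp
      rw [hc, Nat.cast_choose ℚ hj', div_pow, pow_add]
      have := halfRising_ne_zero (p + q)
      have h4 : (j.factorial : ℚ) ≠ 0 := by positivity
      have h5 : ((q - j).factorial : ℚ) ≠ 0 := by positivity
      have h6 : (q.factorial : ℚ) ≠ 0 := by positivity
      field_simp
    rw [Finset.sum_congr rfl hterm, ← Finset.mul_sum, hm, arcsineMoment, zero_add,
      Nat.cast_choose ℚ hi', ← four_pow_mul_halfRising i, add_comm q i]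
    have := halfRising_ne_zero (p + q)
    have := halfRising_ne_zero i
    field_simp
  rw [Finset.sum_congr rfl key, ← Finset.mul_sum, sum_alternating_halfRising]
  have := halfRising_ne_zero (p + q)
  field_simp

/-- Convolution square of the coefficients of `(1 - X)^(-1/2)`. -/
lemma sum_halfRising_mul_halfRising (n : ℕ) :
    ∑ g ∈ Finset.range (n + 1), (n.choose g : ℚ) * (halfRising g * halfRising (n - g)) =
      n.factorial := by
  have h := sum_choose_mul_arcsineMoment n 0 0
  have e : ∀ g ∈ Finset.range (n + 1), (n.choose g : ℚ) * arcsineMoment (0 + g) (0 + (n - g)) =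
      (n.choose g : ℚ) * (halfRising g * halfRising (n - g)) / n.factorial := by
    intro g hg
    have hg' : g ≤ n := Nat.lt_succ_iff.mp (Finset.mem_range.mp hg)
    rw [arcsineMoment, zero_add, zero_add, Nat.add_sub_cancel' hg']
    ring
  rw [Finset.sum_congr rfl e, ← Finset.sum_div, div_eq_iff (by positivity)] at h
  simpa [arcsineMoment] using h

/-- For k ≤ N this is, up to normalization, the derivative of order N - k of the Legendre polynomial
of degree N at 1. The proof uses the recurrence F(N+1, k) = 2(2N+1-k) F(N, k) + 2k F(N, k-1), valid
for k ≤ 2N+1. -/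
lemma sum_gegenbauer_one_aux (N k : ℕ) (hk : k ≤ 2 * N) :
    ∑ j ∈ Finset.range (N + 1), ((-1) ^ j * (2 * (N - j)).factorial /
      ((N - j).factorial * j.factorial) * k.descFactorial (2 * j) : ℚ) =
      2 ^ k * (2 * N - k).descFactorial N := by
  induction N generalizing k with
  | zero =>
    obtain rfl : k = 0 := by omega
    simp
  | succ N ih =>
    rcases Nat.lt_or_ge (2 * N + 1) k with hk2 | hk2
    -- At this extreme value the term j = N + 1 no longer vanishes, and the sum is a multiple of the
    -- alternating sum of a binomial row.
    · obtain rfl : k = 2 * (N + 1) := by omega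
      have h := Int.alternating_sum_range_choose_of_ne (n := N + 1) (by omega)
      have h' : ∑ j ∈ Finset.range (N + 1 + 1), ((-1) ^ j * ((N + 1).choose j) : ℚ) = 0 := by
        exact_mod_cast h
      have e : ∀ j ∈ Finset.range (N + 1 + 1), ((-1) ^ j * (2 * (N + 1 - j)).factorial /
          ((N + 1 - j).factorial * j.factorial) * (2 * (N + 1)).descFactorial (2 * j) : ℚ) =
          (2 * (N + 1)).factorial / (N + 1).factorial * ((-1) ^ j * ((N + 1).choose j)) := by
        intro j hj
        have hj' : j ≤ N + 1 := Nat.lt_succ_iff.mp (Finset.mem_range.mp hj)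
        have h1 := Nat.factorial_mul_descFactorial (show 2 * j ≤ 2 * (N + 1) by omega)
        rw [show 2 * (N + 1) - 2 * j = 2 * (N + 1 - j) by omega] at h1
        have : ((N + 1).factorial : ℚ) ≠ 0 := by positivity
        rw [Nat.cast_choose ℚ hj', ← h1]
        push_cast
        field_simp
      rw [Finset.sum_congr rfl e, ← Finset.mul_sum, h', Nat.sub_self]
      simp
    · have step : ∀ j ∈ Finset.range (N + 1), ((-1) ^ j * (2 * (N + 1 - j)).factorial /
          ((N + 1 - j).factorial * j.factorial) * k.descFactorial (2 * j) : ℚ) =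
          2 * (2 * N + 1 - k) * ((-1) ^ j * (2 * (N - j)).factorial /
            ((N - j).factorial * j.factorial) * k.descFactorial (2 * j)) +
          2 * k * ((-1) ^ j * (2 * (N - j)).factorial /
            ((N - j).factorial * j.factorial) * (k - 1).descFactorial (2 * j)) := by
        intro j hj
        have hj' : j ≤ N := Nat.lt_succ_iff.mp (Finset.mem_range.mp hj)
        have hd : (k : ℚ) * (k - 1).descFactorial (2 * j) =
            (k - 2 * j) * k.descFactorial (2 * j) := by
          rcases k with _ | k
          · rcases j with _ | j <;> simp
          · have h1 := Nat.succ_descFactorial k (2 * j)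
            rcases Nat.lt_or_ge (k + 1) (2 * j) with h2 | h2
            · rw [Nat.descFactorial_eq_zero_iff_lt.mpr h2,
                Nat.descFactorial_eq_zero_iff_lt.mpr (by omega)]
              simp
            · rw [Nat.add_sub_cancel]
              have h3 : ((k + 1 - 2 * j : ℕ) : ℚ) = (k + 1 : ℕ) - 2 * j := by
                rw [Nat.cast_sub h2]; push_cast; ring
              rw [← h3]
              exact_mod_cast h1.symm
        obtain ⟨m, rfl⟩ := Nat.exists_eq_add_of_le hj'
        rw [show j + m + 1 - j = m + 1 by omega, show j + m - j = m by omega,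
          show 2 * (m + 1) = 2 * m + 1 + 1 by ring, Nat.factorial_succ (2 * m + 1),
          Nat.factorial_succ (2 * m), Nat.factorial_succ m]
        have h1 : (m.factorial : ℚ) ≠ 0 := by positivity
        have h2 : (j.factorial : ℚ) ≠ 0 := by positivity
        have h3 : ((m : ℚ) + 1) ≠ 0 := by positivity
        have e2 : 2 * (k : ℚ) * ((-1) ^ j * (2 * m).factorial /
            (m.factorial * j.factorial) * (k - 1).descFactorial (2 * j)) =
            2 * ((-1) ^ j * (2 * m).factorial /
            (m.factorial * j.factorial)) * ((k - 2 * j) * k.descFactorial (2 * j)) := by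
          rw [← hd]; ring
        rw [e2]
        push_cast
        field_simp
        ring
      rw [Finset.sum_range_succ, Finset.sum_congr rfl step, Finset.sum_add_distrib,
        ← Finset.mul_sum, ← Finset.mul_sum,
        Nat.descFactorial_eq_zero_iff_lt.mpr (show k < 2 * (N + 1) by omega)]
      rcases Nat.lt_or_ge (2 * N) k with hk3 | hk3
      -- Here F(N, k) is outside the range of the induction hypothesis, but its factor 2(2N+1-k) is
      -- zero.
      · obtain rfl : k = 2 * N + 1 := by omega
        rw [show 2 * N + 1 - 1 = 2 * N by omega, ih (2 * N) le_rfl,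
          show 2 * (N + 1) - (2 * N + 1) = 1 by omega, Nat.sub_self]
        rcases N with _ | N
        · norm_num
        · rw [Nat.descFactorial_eq_zero_iff_lt.mpr (show 0 < N + 1 by omega),
            Nat.descFactorial_eq_zero_iff_lt.mpr (show 1 < N + 1 + 1 by omega)]
          push_cast
          ring
      · rw [ih k hk3]
        obtain ⟨M, hM⟩ := Nat.exists_eq_add_of_le hk3
        have hMq : (2 * N : ℚ) = k + M := by exact_mod_cast hM
        have h1 : (((M + 1).descFactorial N : ℕ) : ℚ) * (M + 1 - N) =
            (M + 1) * M.descFactorial N := by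
          have := Nat.succ_descFactorial M N
          rcases Nat.lt_or_ge (M + 1) N with h2 | h2
          · rw [Nat.descFactorial_eq_zero_iff_lt.mpr h2,
              Nat.descFactorial_eq_zero_iff_lt.mpr (by omega)]
            simp
          · have h3 : ((M + 1 - N : ℕ) : ℚ) = M + 1 - N := by
              rw [Nat.cast_sub h2]; push_cast; ring
            rw [← h3, mul_comm]
            exact_mod_cast this
        rw [show 2 * N - k = M by omega, show 2 * (N + 1) - k = M + 1 + 1 by omega,
          Nat.succ_descFactorial_succ]
        rcases k with _ | k
        · push_cast at hMq ⊢
          linear_combination (-2 : ℚ) * h1 + 2 * (M.descFactorial N : ℚ) * hMq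
            - ((M + 1).descFactorial N : ℚ) * hMq
        · rw [Nat.add_sub_cancel, ih k (by omega), show 2 * N - k = M + 1 by omega, pow_succ]
          push_cast at hMq ⊢
          linear_combination (-4 * 2 ^ k : ℚ) * h1 + 4 * 2 ^ k * (M.descFactorial N : ℚ) * hMq
            - 2 * 2 ^ k * ((M + 1).descFactorial N : ℚ) * hMq

/-- The terminating sum evaluating a Gegenbauer polynomial at `1`. -/
lemma sum_gegenbauer_one (n k l : ℕ) (hk : k ≤ n) (hl : k ≤ 2 * l) (hln : 2 * l ≤ n) :
    ∑ j ∈ Finset.range (l + 1), ((-1) ^ j * (2 * (n - j)).factorial /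
      ((n - j).factorial * j.factorial) * k.descFactorial (2 * j) : ℚ) =
      2 ^ k * ((2 * n - k).factorial / (n - k).factorial) := by
  have h := sum_gegenbauer_one_aux n k (by omega)
  have h2 := Nat.factorial_mul_descFactorial (show n ≤ 2 * n - k by omega)
  rw [show 2 * n - k - n = n - k by omega] at h2
  rw [← h2, Nat.cast_mul, mul_div_cancel_left₀ _ (by positivity), ← h]
  refine Finset.sum_subset (fun j hj => ?_) fun j _ hj => ?_
  · simp only [Finset.mem_range] at hj ⊢; omega
  · simp only [Finset.mem_range] at hj
    rw [Nat.descFactorial_eq_zero_iff_lt.mpr (by omega)]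
    simp

/-- Two expansions of the coefficients of `((1 + cT)² - 4q - 4T)^(-1/2)`, where `c = 2 - b`. -/
lemma sum_legendre {R : Type*} [CommRing R] [Algebra ℚ R] (b : R) (h l : ℕ) :
    ∑ k ∈ Finset.range (2 * l + 1), algebraMap ℚ R ((2 * (h + 2 * l) - k).factorial /
      (k.factorial * (h + 2 * l - k).factorial * h.factorial * (2 * l - k).factorial)) *
        (b - 2) ^ k =
    ∑ j ∈ Finset.range (l + 1), algebraMap ℚ R (halfRising (2 * (l - j) + j + h) *
      4 ^ (l - j + h) / ((2 * (l - j)).factorial * j.factorial * h.factorial)) *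
        (b ^ (2 * (l - j)) * (-(2 - b) ^ 2) ^ j) := by
  set n := h + 2 * l with hn
  -- Expand b^(2(l-j)) by the binomial theorem around b - 2. The falling factorial vanishes for k <
  -- 2j, so all `j` share one range of `k`, and the coefficient of (b-2)^k becomes the Gegenbauer
  -- sum.
  have hterm : ∀ j ∈ Finset.range (l + 1), algebraMap ℚ R (halfRising (2 * (l - j) + j + h) *
      4 ^ (l - j + h) / ((2 * (l - j)).factorial * j.factorial * h.factorial)) *
        (b ^ (2 * (l - j)) * (-(2 - b) ^ 2) ^ j) =
      ∑ k ∈ Finset.range (2 * l + 1), algebraMap ℚ R ((-1) ^ j * (2 * (n - j)).factorial /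
        ((n - j).factorial * j.factorial) * k.descFactorial (2 * j) *
        (2⁻¹ ^ k / (k.factorial * h.factorial * (2 * l - k).factorial))) * (b - 2) ^ k := by
    intro j hj
    have hj' : j ≤ l := Nat.lt_succ_iff.mp (Finset.mem_range.mp hj)
    obtain ⟨i, rfl⟩ := Nat.exists_eq_add_of_le hj'
    rw [show 2 * (j + i) + 1 = 2 * j + (2 * i + 1) by ring, Finset.sum_range_add,
      Finset.sum_eq_zero (s := Finset.range (2 * j)), zero_add]
    · have hb : b ^ (2 * i) = ((b - 2) + 2) ^ (2 * i) := by ring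
      rw [show j + i - j = i by omega, hb, add_pow, Finset.sum_mul, Finset.mul_sum]
      refine Finset.sum_congr rfl fun t ht => ?_
      have ht' : t ≤ 2 * i := Nat.lt_succ_iff.mp (Finset.mem_range.mp ht)
      have hsq : (-(2 - b) ^ 2) ^ j = algebraMap ℚ R ((-1) ^ j) * (b - 2) ^ (2 * j) := by
        rw [neg_pow, ← pow_mul, ← Even.neg_pow (even_two_mul j) (2 - b), neg_sub]
        simp
      have h2 : (2 : R) ^ (2 * i - t) = algebraMap ℚ R (2 ^ (2 * i - t)) := by
        rw [map_pow, map_ofNat]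
      have hch : (((2 * i).choose t : ℕ) : R) = algebraMap ℚ R ((2 * i).choose t) := by simp
      rw [hsq, h2, hch]
      have hq : halfRising (2 * i + j + h) * 4 ^ (i + h) /
          ((2 * i).factorial * j.factorial * h.factorial) * ((-1) ^ j) * 2 ^ (2 * i - t) *
            ((2 * i).choose t) =
          (-1) ^ j * (2 * (n - j)).factorial /
        ((n - j).factorial * j.factorial) * (2 * j + t).descFactorial (2 * j) *
        (2⁻¹ ^ (2 * j + t) / ((2 * j + t).factorial * h.factorial *
          (2 * (j + i) - (2 * j + t)).factorial)) := by
        have hd := Nat.factorial_mul_descFactorial (show 2 * j ≤ 2 * j + t by omega)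
        rw [show 2 * j + t - 2 * j = t by omega] at hd
        obtain ⟨m, hm⟩ := Nat.exists_eq_add_of_le ht'
        have hnj : n - j = 2 * i + j + h := by omega
        rw [← hd, hnj, ← four_pow_mul_halfRising (2 * i + j + h), Nat.cast_choose ℚ ht',
          show 2 * (j + i) - (2 * j + t) = m by omega, show 2 * i - t = m by omega,
          show 2 * i + j + h = (i + h) + (i + j) by ring, pow_add 4 (i + h) (i + j)]
        have hdp : ((2 * j + t).descFactorial (2 * j) : ℚ) ≠ 0 := by
          rw [Nat.cast_ne_zero, ne_eq, Nat.descFactorial_eq_zero_iff_lt]; omega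
        have h4 : (4 : ℚ) ^ (i + j) = 2 ^ (2 * j + t) * 2 ^ m := by
          rw [show (4 : ℚ) = 2 ^ 2 by norm_num, ← pow_mul, ← pow_add]
          congr 1; omega
        rw [h4, inv_pow]
        push_cast
        field_simp
      rw [← hq]
      simp only [map_mul, pow_add]
      ring
    · intro k hk
      rw [Nat.descFactorial_eq_zero_iff_lt.mpr (Finset.mem_range.mp hk)]
      simp
  rw [Finset.sum_congr rfl hterm, Finset.sum_comm]
  refine Finset.sum_congr rfl fun k hk => ?_
  have hk' : k ≤ 2 * l := Nat.lt_succ_iff.mp (Finset.mem_range.mp hk)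
  rw [← Finset.sum_mul, ← map_sum, ← Finset.sum_mul,
    sum_gegenbauer_one n k l (by omega) hk' (by omega), inv_pow]
  congr 2
  field_simp

end SquareWalk

namespace SquareWalk

/-! ### Linear recurrence for words weighted by corners. -/

section WordSums

variable {A : Type*} [CommRing A] (a : A) (ξ : Step → A)

/-- The sum of the weights of all words of length `n`. -/
def wordSum (n : ℕ) : A :=
  ∑ w : Fin n → Step, a ^ numCorners (List.ofFn w) * ∏ k, ξ (w k)

/-- The sum of the weights of all words of length `n`, the corner with a preceding letter `x`
being taken into account. -/
def wordSumAfter (x : Step) (n : ℕ) : A :=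
  ∑ w : Fin n → Step, a ^ numCorners (x :: List.ofFn w) * ∏ k, ξ (w k)

lemma sum_step (f : Step → A) :
    ∑ x, f x = f .east + f .north + f .west + f .south := by
  have : (Finset.univ : Finset Step) = {.east, .north, .west, .south} := rfl
  rw [this]
  simp [add_assoc]

lemma sum_words_succ {n : ℕ} (f : (Fin (n + 1) → Step) → A) :
    ∑ w, f w = ∑ x, ∑ w : Fin n → Step, f (Fin.cons x w) := by
  rw [← Fintype.sum_prod_type' (f := fun x w => f (Fin.cons x w))]
  exact (Fintype.sum_equiv (Fin.consEquiv fun _ => Step) _ _ fun _ => rfl).symm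

lemma wordSum_succ (n : ℕ) : wordSum a ξ (n + 1) = ∑ x, ξ x * wordSumAfter a ξ x n := by
  rw [wordSum, sum_words_succ]
  refine Finset.sum_congr rfl fun x _ => ?_
  rw [wordSumAfter, Finset.mul_sum]
  refine Finset.sum_congr rfl fun w _ => ?_
  rw [Fin.prod_univ_succ]
  simp only [List.ofFn_succ, Fin.cons_zero, Fin.cons_succ]
  ring

lemma wordSumAfter_succ (x : Step) (n : ℕ) : wordSumAfter a ξ x (n + 1) = ∑ y, ξ y *
    ((if (x = .north ∧ y = .west) ∨ (x = .east ∧ y = .south) then a else 1) *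
      wordSumAfter a ξ y n) := by
  rw [wordSumAfter, sum_words_succ]
  refine Finset.sum_congr rfl fun y _ => ?_
  rw [wordSumAfter, Finset.mul_sum, Finset.mul_sum]
  refine Finset.sum_congr rfl fun w _ => ?_
  rw [Fin.prod_univ_succ]
  simp only [List.ofFn_succ, Fin.cons_zero, Fin.cons_succ, numCorners]
  split_ifs <;> ring

lemma wordSumAfter_zero (x : Step) : wordSumAfter a ξ x 0 = 1 := by
  simp [wordSumAfter, numCorners]

lemma wordSum_zero : wordSum a ξ 0 = 1 := by
  simp [wordSum, numCorners]

/-- No counted corner begins with `W`, so the preceding letter has no effect. -/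
lemma wordSumAfter_west (n : ℕ) : wordSumAfter a ξ .west n = wordSum a ξ n := by
  cases n with
  | zero => rw [wordSumAfter_zero, wordSum_zero]
  | succ n => rw [wordSumAfter_succ, wordSum_succ]; simp

lemma wordSumAfter_south (n : ℕ) : wordSumAfter a ξ .south n = wordSum a ξ n := by
  cases n with
  | zero => rw [wordSumAfter_zero, wordSum_zero]
  | succ n => rw [wordSumAfter_succ, wordSum_succ]; simp

/-- Only a following `W` changes the weight, by a - 1; after that `W` the word is unconstrained. -/
lemma wordSumAfter_north (n : ℕ) : wordSumAfter a ξ .north (n + 1) =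
    wordSum a ξ (n + 1) + (a - 1) * ξ .west * wordSum a ξ n := by
  rw [wordSumAfter_succ, wordSum_succ, sum_step, sum_step, ← wordSumAfter_west a ξ n]
  simp
  ring

lemma wordSumAfter_east (n : ℕ) : wordSumAfter a ξ .east (n + 1) =
    wordSum a ξ (n + 1) + (a - 1) * ξ .south * wordSum a ξ n := by
  rw [wordSumAfter_succ, wordSum_succ, sum_step, sum_step, ← wordSumAfter_south a ξ n]
  simp
  ring

lemma wordSum_one : wordSum a ξ 1 = ∑ x, ξ x := by
  rw [wordSum_succ]
  simp [wordSumAfter_zero]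

/-- The counted corners begin with `N` or `E` and end with `W` or `S`; they cannot overlap, so the
recurrence closes at order two. -/
lemma wordSum_add_two (n : ℕ) : wordSum a ξ (n + 2) = (∑ x, ξ x) * wordSum a ξ (n + 1) +
    (a - 1) * (ξ .north * ξ .west + ξ .east * ξ .south) * wordSum a ξ n := by
  rw [wordSum_succ, sum_step, sum_step, wordSumAfter_north, wordSumAfter_east, wordSumAfter_south,
    wordSumAfter_west]
  ring

/-- The sum `∑ k, (n - k choose k) σ ^ (n - 2k) π ^ k` satisfies a Fibonacci-like recurrence. -/
lemma fibSum_add_two (σ π : A) (n : ℕ) :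
    ∑ k ∈ Finset.range (n + 3), ((n + 2 - k).choose k : A) * σ ^ (n + 2 - 2 * k) * π ^ k =
      σ * (∑ k ∈ Finset.range (n + 2), ((n + 1 - k).choose k : A) * σ ^ (n + 1 - 2 * k) * π ^ k) +
      π * ∑ k ∈ Finset.range (n + 1), ((n - k).choose k : A) * σ ^ (n - 2 * k) * π ^ k := by
  rw [Finset.sum_range_succ' _ (n + 2), Finset.sum_range_succ _ (n + 1),
    Finset.sum_range_succ' _ (n + 1)]
  have h0 : (n + 2 - (n + 1 + 1)).choose (n + 1 + 1) = 0 := by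
    apply Nat.choose_eq_zero_of_lt; omega
  rw [h0]
  have h : ∀ k ∈ Finset.range (n + 1),
      ((n + 2 - (k + 1)).choose (k + 1) : A) * σ ^ (n + 2 - 2 * (k + 1)) * π ^ (k + 1) =
      σ * (((n + 1 - (k + 1)).choose (k + 1) : A) * σ ^ (n + 1 - 2 * (k + 1)) * π ^ (k + 1)) +
      π * (((n - k).choose k : A) * σ ^ (n - 2 * k) * π ^ k) := by
    intro k hk
    have hk' : k ≤ n := Nat.lt_succ_iff.mp (Finset.mem_range.mp hk)
    rw [show n + 2 - (k + 1) = n - k + 1 by omega, Nat.choose_succ_succ,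
      show n + 1 - (k + 1) = n - k by omega, show n + 2 - 2 * (k + 1) = n - 2 * k by omega]
    push_cast
    -- The exponents use truncated subtraction; where it truncates, the binomial coefficient is
    -- zero.
    rcases Nat.lt_or_ge (n - k) (k + 1) with h1 | h1
    · rw [Nat.choose_eq_zero_of_lt h1]
      push_cast
      ring
    · rw [show n - 2 * k = n + 1 - 2 * (k + 1) + 1 by omega]
      ring
  rw [Finset.sum_congr rfl h, Finset.sum_add_distrib, ← Finset.mul_sum, ← Finset.mul_sum]
  simp only [Nat.cast_zero, zero_mul, add_zero, Nat.choose_zero_right, Nat.cast_one, one_mul,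
    Nat.sub_zero, mul_zero, pow_zero, mul_one]
  ring

lemma wordSum_eq_sum (n : ℕ) : wordSum a ξ n =
    ∑ k ∈ Finset.range (n + 1), ((n - k).choose k : A) * (∑ x, ξ x) ^ (n - 2 * k) *
      ((a - 1) * (ξ .north * ξ .west + ξ .east * ξ .south)) ^ k := by
  induction n using Nat.twoStepInduction with
  | zero => simp [wordSum_zero]
  | one => simp [wordSum_one, Finset.sum_range_succ]
  | more n ih1 ih2 => rw [wordSum_add_two, fibSum_add_two, ih1, ih2]

end WordSums

/-! ### Balanced parts of powers of σ and τ. -/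

section Diagonal

open MvPolynomial

variable {R : Type*} [CommRing R] (x y : R)

/-- The linear functional that keeps the balanced monomials `(EW)^i (NS)^j` and maps them to
`x^i y^j`. -/
noncomputable def balancedPart : MvPolynomial Step R →ₗ[R] R :=
  (basisMonomials Step R).constr R fun m =>
    if m .east = m .west ∧ m .north = m .south then x ^ m .east * y ^ m .north else 0

lemma balancedPart_monomial (m : Step →₀ ℕ) (r : R) :
    balancedPart x y (monomial m r) =
      if m .east = m .west ∧ m .north = m .south then r * (x ^ m .east * y ^ m .north) else 0 := by
  have h : monomial m r = r • basisMonomials Step R m := by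
    rw [coe_basisMonomials, smul_monomial, smul_eq_mul, mul_one]
  rw [h, map_smul, balancedPart, Module.Basis.constr_basis, smul_eq_mul, mul_ite, mul_zero]

/-- Although not multiplicative, the functional is linear over the balanced products EW and NS. -/
lemma balancedPart_east_west_mul (f : MvPolynomial Step R) :
    balancedPart x y (X .east * X .west * f) = x * balancedPart x y f := by
  induction f using MvPolynomial.induction_on' with
  | monomial m r =>
    rw [X, X, monomial_mul, monomial_mul, balancedPart_monomial, balancedPart_monomial]
    simp
    split_ifs <;> ring
  | add p q hp hq => rw [mul_add, map_add, hp, hq, map_add, mul_add]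

lemma balancedPart_north_south_mul (f : MvPolynomial Step R) :
    balancedPart x y (X .north * X .south * f) = y * balancedPart x y f := by
  induction f using MvPolynomial.induction_on' with
  | monomial m r =>
    rw [X, X, monomial_mul, monomial_mul, balancedPart_monomial, balancedPart_monomial]
    simp
    split_ifs <;> ring
  | add p q hp hq => rw [mul_add, map_add, hp, hq, map_add, mul_add]

/-- The grading in which `E` and `N` steps go up, and `W` and `S` steps go down. -/
def upDown : Step → ℤ
  | .east => 1
  | .north => 1
  | .west => -1
  | .south => -1

lemma weight_upDown (m : Step →₀ ℕ) :
    Finsupp.weight upDown m = m .east + m .north - m .west - m .south := by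
  rw [Finsupp.weight_apply, Finsupp.sum_fintype _ _ (by simp), sum_step]
  simp [upDown]
  ring

/-- Balanced monomials have degree 0 in the up-down grading. -/
lemma balancedPart_eq_zero {f : MvPolynomial Step R} {d : ℤ}
    (hf : IsWeightedHomogeneous upDown f d) (hd : d ≠ 0) : balancedPart x y f = 0 := by
  rw [← f.support_sum_monomial_coeff, map_sum]
  refine Finset.sum_eq_zero fun m hm => ?_
  rw [balancedPart_monomial, if_neg]
  rintro ⟨h1, h2⟩
  apply hd
  rw [← hf (mem_support_iff.mp hm), weight_upDown, h1, h2]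
  ring

/-- The value of `balancedPart` on `(NW + ES)^n`. -/
def balancedCorner (n : ℕ) : R := if Even n then (n.choose (n / 2) : R) * (x * y) ^ (n / 2) else 0

/-- The monomial (NW)^k(ES)^(n-k) is balanced exactly when k = n - k. -/
lemma balancedPart_corner_pow (n : ℕ) :
    balancedPart x y ((X .north * X .west + X .east * X .south) ^ n) = balancedCorner x y n := by
  rw [add_pow, map_sum]
  have h : ∀ k ∈ Finset.range (n + 1), balancedPart x y ((X .north * X .west) ^ k *
      (X .east * X .south) ^ (n - k) * (n.choose k : MvPolynomial Step R)) =
      if n - k = k then (n.choose k : R) * (x ^ k * y ^ k) else 0 := by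
    intro k _
    have e : (X .north * X .west) ^ k * (X .east * X .south) ^ (n - k) *
        (n.choose k : MvPolynomial Step R) =
        monomial (Finsupp.single .north k + Finsupp.single .west k +
          Finsupp.single .east (n - k) + Finsupp.single .south (n - k)) (n.choose k : R) := by
      rw [← map_natCast C, mul_comm, mul_pow, mul_pow, monomial_eq]
      rw [Finsupp.prod_fintype _ _ (by simp)]
      have : (Finset.univ : Finset Step) = {.east, .north, .west, .south} := rfl
      rw [this]
      simp
      ring
    rw [e, balancedPart_monomial]
    simp only [Finsupp.add_apply, Finsupp.single_apply, reduceCtorEq, if_true, if_false, zero_add,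
      add_zero]
    by_cases hk : n - k = k
    · rw [hk, if_pos ⟨rfl, rfl⟩, if_pos rfl]
    · rw [if_neg fun h => hk h.1, if_neg hk]
  rw [Finset.sum_congr rfl h, balancedCorner]
  split_ifs with hn
  · obtain ⟨m, rfl⟩ := hn
    rw [Finset.sum_eq_single m, if_pos (by omega), show (m + m) / 2 = m by omega, mul_pow]
    · intro k _ hk
      rw [if_neg (by omega)]
    · intro hm
      exact absurd (Finset.mem_range.mpr (by omega)) hm
  · refine Finset.sum_eq_zero fun k hk => if_neg fun h => hn ⟨k, ?_⟩
    have := Finset.mem_range.mp hk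
    omega

lemma balancedPart_add_pow_mul (h : ℕ) (f : MvPolynomial Step R) :
    balancedPart x y ((X .east * X .west + X .north * X .south) ^ h * f) =
      (x + y) ^ h * balancedPart x y f := by
  induction h generalizing f with
  | zero => simp
  | succ h ih =>
    rw [pow_succ, mul_assoc, ih, add_mul, map_add, balancedPart_east_west_mul,
      balancedPart_north_south_mul]
    ring

/-- Split σ = u + d into its parts of degree 1 and -1. As τ has degree 0, only u^p d^p contributes,
and ud = EW + NS + τ, whose balanced products factor out as powers of x + y. -/
lemma balancedPart_sum_pow_mul (p k : ℕ) :
    balancedPart x y ((∑ s, X s) ^ (2 * p) * (X .north * X .west + X .east * X .south) ^ k) =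
      ((2 * p).choose p : R) * ∑ h ∈ Finset.range (p + 1),
        (p.choose h : R) * (x + y) ^ h * balancedCorner x y (p - h + k) := by
  set τ : MvPolynomial Step R := X .north * X .west + X .east * X .south with hτ
  set u : MvPolynomial Step R := X .east + X .north with hu
  set d : MvPolynomial Step R := X .west + X .south with hd
  have hX : ∀ s, IsWeightedHomogeneous upDown (X s : MvPolynomial Step R) (upDown s) :=
    fun s => isWeightedHomogeneous_X R upDown s
  have hu' : IsWeightedHomogeneous upDown u 1 := (hX .east).add (hX .north)
  have hd' : IsWeightedHomogeneous upDown d (-1) := (hX .west).add (hX .south)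
  have hτ' : IsWeightedHomogeneous upDown τ 0 :=
    ((hX .north).mul (hX .west)).add ((hX .east).mul (hX .south))
  have hσ : (∑ s, X s : MvPolynomial Step R) = u + d := by rw [sum_step]; ring
  have hud : u * d = (X .east * X .west + X .north * X .south) + τ := by ring
  rw [hσ, add_pow, Finset.sum_mul, map_sum, Finset.sum_eq_single p]
  · rw [show 2 * p - p = p by omega, ← mul_pow, hud, add_pow, ← map_natCast (C (R := R)),
      mul_comm _ (C _), mul_assoc, ← smul_eq_C_mul, map_smul, smul_eq_mul, Finset.sum_mul, map_sum]
    congr 1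
    refine Finset.sum_congr rfl fun h _ => ?_
    rw [← map_natCast (C (R := R)), mul_comm _ (C _), mul_assoc, ← smul_eq_C_mul, map_smul,
      smul_eq_mul, mul_assoc, ← pow_add, balancedPart_add_pow_mul, balancedPart_corner_pow]
    ring
  · intro i hi hip
    have hi' : i ≤ 2 * p := Nat.lt_succ_iff.mp (Finset.mem_range.mp hi)
    -- The degree is 2i - 2p, nonzero away from the middle term.
    refine balancedPart_eq_zero x y (d := i • 1 + (2 * p - i) • (-1) + 0 + k • 0) ?_ ?_
    · rw [← map_natCast (C (R := R))]
      exact (((hu'.pow i).mul (hd'.pow _)).mul (isWeightedHomogeneous_C _ _)).mul (hτ'.pow k)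
    · simp
      omega
  · intro hp
    exact absurd (Finset.mem_range.mpr (by omega)) hp

end Diagonal

end SquareWalk

namespace SquareWalk

/-! ### Loop polynomials as balanced parts of word sums. -/

lemma numHorizontal_eq (l : List Step) :
    numHorizontal l = l.count .east + l.count .west := by
  induction l with
  | nil => rfl
  | cons s l ih =>
    rw [numHorizontal, List.countP_cons, ← numHorizontal, ih]
    cases s <;> simp [Step.IsHorizontal] <;> ring

lemma numVertical_eq (l : List Step) :
    numVertical l = l.count .north + l.count .south := by
  induction l with
  | nil => rfl
  | cons s l ih =>
    rw [numVertical, List.countP_cons, ← numVertical, ih]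
    cases s <;> simp [Step.IsVertical] <;> ring

lemma endpoint_eq (l : List Step) :
    endpoint l = ((l.count .east : ℤ) - l.count .west, (l.count .north : ℤ) - l.count .south) := by
  induction l with
  | nil => rfl
  | cons s l ih =>
    rw [endpoint, List.map_cons, List.sum_cons, ← endpoint, ih]
    cases s <;> simp [Step.vec] <;> ring

lemma length_eq_count (l : List Step) :
    l.length = l.count .east + l.count .west + (l.count .north + l.count .south) := by
  induction l with
  | nil => rfl
  | cons s l ih =>
    rw [List.length_cons, ih]
    cases s <;> simp <;> ring

lemma isLoop_iff (i j : ℕ) (l : List Step) :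
    (numHorizontal l = 2 * i ∧ numVertical l = 2 * j ∧ endpoint l = (0, 0)) ↔
      (l.count .east = l.count .west ∧ l.count .north = l.count .south) ∧
        l.count .east = i ∧ l.count .north = j := by
  rw [numHorizontal_eq, numVertical_eq, endpoint_eq, Prod.mk.injEq]
  omega

lemma cornerPoly_eq_zero (i j : ℕ) (h : ¬(Even i ∧ Even j)) : cornerPoly i j (0, 0) = 0 := by
  rw [cornerPoly, walks, Finset.filter_false_of_mem, Finset.sum_empty]
  rintro w - ⟨h1, h2, h3⟩
  rw [numHorizontal_eq] at h1
  rw [numVertical_eq] at h2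
  rw [endpoint_eq, Prod.mk.injEq] at h3
  exact h ⟨⟨(List.ofFn w).count .east, by omega⟩, ⟨(List.ofFn w).count .north, by omega⟩⟩

/-- The polynomial counting the loops with `2i` horizontal and `2j` vertical steps. -/
noncomputable def loopPoly (i j : ℕ) : ℤ[X] := cornerPoly (2 * i) (2 * j) (0, 0)

section

variable {R : Type*} [CommRing R]

lemma aeval_loopPoly (a : R) (i j N : ℕ) (hN : 2 * i + 2 * j = N) :
    Polynomial.aeval a (loopPoly i j) =
      ∑ w : Fin N → Step, if ((List.ofFn w).count .east = (List.ofFn w).count .west ∧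
        (List.ofFn w).count .north = (List.ofFn w).count .south) ∧
        (List.ofFn w).count .east = i ∧ (List.ofFn w).count .north = j then
          a ^ numCorners (List.ofFn w) else 0 := by
  subst hN
  rw [loopPoly, cornerPoly, map_sum, ← Finset.sum_filter]
  refine Finset.sum_congr (Finset.filter_congr fun w _ => isLoop_iff i j _) fun w _ => ?_
  simp

lemma prod_X_eq_monomial {n : ℕ} (w : Fin n → Step) :
    (∏ k, MvPolynomial.X (w k) : MvPolynomial Step R) =
      MvPolynomial.monomial (∑ k, Finsupp.single (w k) 1) 1 := by
  rw [MvPolynomial.monomial_sum_one]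
  rfl

lemma sum_single_apply {n : ℕ} (w : Fin n → Step) (s : Step) :
    (∑ k, Finsupp.single (w k) 1 : Step →₀ ℕ) s = (List.ofFn w).count s := by
  rw [Finsupp.finsetSum_apply]
  induction n with
  | zero => simp
  | succ n ih =>
    rw [Fin.sum_univ_succ, List.ofFn_succ, List.count_cons, ih (fun k => w k.succ), add_comm]
    simp [Finsupp.single_apply]

/-- A balanced word of length 2n determines (i, j) by its numbers of `E` and `N` steps, so each word
meets exactly one term of the antidiagonal. -/
lemma sum_aeval_loopPoly (a x y : R) (n : ℕ) :
    ∑ p ∈ Finset.HasAntidiagonal.antidiagonal n, Polynomial.aeval a (loopPoly p.1 p.2) * (x ^ p.1 * y ^ p.2) =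
      balancedPart x y (wordSum (MvPolynomial.C a) MvPolynomial.X (2 * n)) := by
  rw [wordSum, map_sum]
  have h : ∀ p ∈ Finset.HasAntidiagonal.antidiagonal n,
      Polynomial.aeval a (loopPoly p.1 p.2) * (x ^ p.1 * y ^ p.2) =
      ∑ w : Fin (2 * n) → Step, if ((List.ofFn w).count .east = (List.ofFn w).count .west ∧
        (List.ofFn w).count .north = (List.ofFn w).count .south) ∧
        (List.ofFn w).count .east = p.1 ∧ (List.ofFn w).count .north = p.2 then
          a ^ numCorners (List.ofFn w) * (x ^ p.1 * y ^ p.2) else 0 := by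
    intro p hp
    have := Finset.HasAntidiagonal.mem_antidiagonal.mp hp
    rw [aeval_loopPoly a p.1 p.2 (2 * n) (by omega), Finset.sum_mul]
    exact Finset.sum_congr rfl fun w _ => by rw [ite_mul, zero_mul]
  rw [Finset.sum_congr rfl h, Finset.sum_comm]
  refine Finset.sum_congr rfl fun w _ => ?_
  rw [prod_X_eq_monomial, ← MvPolynomial.C_pow, MvPolynomial.C_mul_monomial, mul_one,
    balancedPart_monomial]
  simp only [sum_single_apply]
  have hlen := length_eq_count (List.ofFn w)
  rw [List.length_ofFn] at hlen
  split_ifs with hb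
  · rw [Finset.sum_eq_single ((List.ofFn w).count .east, (List.ofFn w).count .north)]
    · rw [if_pos ⟨hb, rfl, rfl⟩]
    · rintro ⟨i, j⟩ _ hij
      rw [if_neg]
      rintro ⟨-, rfl, rfl⟩
      exact hij rfl
    · intro hn
      refine absurd (Finset.HasAntidiagonal.mem_antidiagonal.mpr ?_) hn
      simp only
      omega
  · exact Finset.sum_eq_zero fun p _ => if_neg fun hp => hb hp.1

lemma balancedPart_wordSum (a x y : R) (n : ℕ) :
    balancedPart x y (wordSum (MvPolynomial.C a) MvPolynomial.X (2 * n)) =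
      ∑ k ∈ Finset.range (n + 1), ((2 * n - k).choose k : R) * (a - 1) ^ k *
        (((2 * (n - k)).choose (n - k) : R) * ∑ h ∈ Finset.range (n - k + 1),
          ((n - k).choose h : R) * (x + y) ^ h * balancedCorner x y (n - h)) := by
  rw [wordSum_eq_sum, map_sum]
  symm
  refine Finset.sum_subset_zero_on_sdiff (fun k hk => ?_) (fun k hk => ?_) fun k hk => ?_
  · simp only [Finset.mem_range] at hk ⊢; omega
  · simp only [Finset.mem_sdiff, Finset.mem_range] at hk
    rw [Nat.choose_eq_zero_of_lt (by omega)]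
    simp
  · have hk' : k ≤ n := Nat.lt_succ_iff.mp (Finset.mem_range.mp hk)
    rw [mul_pow, show 2 * n - 2 * k = 2 * (n - k) by omega]
    have e : ((2 * n - k).choose k : MvPolynomial Step R) *
        (∑ s, MvPolynomial.X s) ^ (2 * (n - k)) * ((MvPolynomial.C a - 1) ^ k *
          (MvPolynomial.X .north * MvPolynomial.X .west +
            MvPolynomial.X .east * MvPolynomial.X .south) ^ k) =
        (((2 * n - k).choose k : R) * (a - 1) ^ k) •
          ((∑ s, MvPolynomial.X s) ^ (2 * (n - k)) * (MvPolynomial.X .north * MvPolynomial.X .west +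
            MvPolynomial.X .east * MvPolynomial.X .south) ^ k) := by
      rw [MvPolynomial.smul_eq_C_mul]
      simp only [map_mul, map_pow, map_sub, map_natCast, map_one]
      ring
    rw [e, map_smul, smul_eq_mul, balancedPart_sum_pow_mul]
    congr 2
    refine Finset.sum_congr rfl fun h hh => ?_
    have hh' : h ≤ n - k := Nat.lt_succ_iff.mp (Finset.mem_range.mp hh)
    rw [show n - k - h + k = n - h by omega]

/-- The coefficient of `(x + y)^h (xy)^(i + j)` in the generating function of loops. -/
def legendreCoeff (h i j : ℕ) : ℚ :=
  (2 * (i + j)).choose (i + j) * (halfRising (2 * i + j + h) * 4 ^ (i + h) /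
    ((2 * i).factorial * j.factorial * h.factorial))

/-- Loops of length `2n` by numbers of steps and corners, expanded along `x + y` and `xy`. -/
lemma sum_aeval_loopPoly_eq [Algebra ℚ R] (b x y : R) (n : ℕ) :
    ∑ p ∈ Finset.HasAntidiagonal.antidiagonal n,
      Polynomial.aeval (b - 1) (loopPoly p.1 p.2) * (x ^ p.1 * y ^ p.2) =
    ∑ l ∈ Finset.range (n / 2 + 1), ∑ j ∈ Finset.range (l + 1),
      algebraMap ℚ R (legendreCoeff (n - 2 * l) (l - j) j) *
        (b ^ (2 * (l - j)) * (-(2 - b) ^ 2) ^ j * ((x + y) ^ (n - 2 * l) * (x * y) ^ l)) := by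
  rw [sum_aeval_loopPoly, balancedPart_wordSum]
  have hL : ∀ k ∈ Finset.range (n + 1), ((2 * n - k).choose k : R) * (b - 1 - 1) ^ k *
        (((2 * (n - k)).choose (n - k) : R) * ∑ h ∈ Finset.range (n - k + 1),
          ((n - k).choose h : R) * (x + y) ^ h * balancedCorner x y (n - h)) =
      ∑ h ∈ Finset.range (n + 1), if k + h ≤ n then
        algebraMap ℚ R ((2 * n - k).factorial /
      (k.factorial * (n - k).factorial * h.factorial * (n - h - k).factorial)) *
        (b - 2) ^ k * (x + y) ^ h * balancedCorner x y (n - h) else 0 := by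
    intro k hk
    have hk' : k ≤ n := Nat.lt_succ_iff.mp (Finset.mem_range.mp hk)
    rw [Finset.mul_sum, Finset.mul_sum]
    refine Finset.sum_subset_zero_on_sdiff (fun h hh => ?_) (fun h hh => ?_) fun h hh => ?_
    · simp only [Finset.mem_range] at hh ⊢; omega
    · simp only [Finset.mem_sdiff, Finset.mem_range] at hh
      rw [if_neg (by omega)]
    · have hh' : h ≤ n - k := Nat.lt_succ_iff.mp (Finset.mem_range.mp hh)
      rw [if_pos (by omega)]
      have e : ((2 * n - k).factorial /
          (k.factorial * (n - k).factorial * h.factorial * (n - h - k).factorial) : ℚ) =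
          (2 * n - k).choose k * (2 * (n - k)).choose (n - k) * (n - k).choose h := by
        rw [Nat.cast_choose ℚ (show k ≤ 2 * n - k by omega),
          Nat.cast_choose ℚ (show n - k ≤ 2 * (n - k) by omega), Nat.cast_choose ℚ hh',
          show 2 * n - k - k = 2 * (n - k) by omega, show 2 * (n - k) - (n - k) = n - k by omega,
          show n - h - k = n - k - h by omega]
        field_simp
      rw [e]
      simp only [map_mul, map_natCast]
      ring
  rw [Finset.sum_congr rfl hL, Finset.sum_comm]
  -- Only even n - h survive in `balancedCorner`; reindex by h = n - 2l.
  have hR : ∑ h ∈ Finset.range (n + 1), ∑ k ∈ Finset.range (n + 1), (if k + h ≤ n then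
        algebraMap ℚ R ((2 * n - k).factorial /
      (k.factorial * (n - k).factorial * h.factorial * (n - h - k).factorial)) *
        (b - 2) ^ k * (x + y) ^ h * balancedCorner x y (n - h) else 0) =
      ∑ l ∈ Finset.range (n / 2 + 1), ∑ k ∈ Finset.range (2 * l + 1),
        algebraMap ℚ R ((2 * n - k).factorial /
      (k.factorial * (n - k).factorial * (n - 2 * l).factorial * (2 * l - k).factorial)) *
        (b - 2) ^ k * (x + y) ^ (n - 2 * l) * balancedCorner x y (2 * l) := by
    symm
    refine Finset.sum_of_injOn (fun l => n - 2 * l) ?_ ?_ ?_ ?_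
    · intro l hl l' hl' hll
      simp only [Finset.coe_range, Set.mem_Iio] at hl hl' hll
      omega
    · intro l hl
      simp only [Finset.coe_range, Set.mem_Iio] at hl ⊢
      omega
    · intro h hh hn
      refine Finset.sum_eq_zero fun k _ => ?_
      simp only [Finset.mem_range] at hh
      have hz : balancedCorner x y (n - h) = 0 := by
        refine if_neg ?_
        rintro ⟨m, hm⟩
        refine hn ⟨m, ?_, ?_⟩
        · simp only [Finset.coe_range, Set.mem_Iio]; omega
        · simp only; omega
      rw [hz]
      simp
    · intro l hl
      have hl' : l ≤ n / 2 := Nat.lt_succ_iff.mp (Finset.mem_range.mp hl)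
      have hn : n - (n - 2 * l) = 2 * l := by omega
      rw [hn]
      refine Finset.sum_subset_zero_on_sdiff (fun k hk => ?_) (fun k hk => ?_) fun k hk => ?_
      · simp only [Finset.mem_range] at hk ⊢; omega
      · simp only [Finset.mem_sdiff, Finset.mem_range] at hk
        rw [if_neg (by omega)]
      · simp only [Finset.mem_range] at hk
        rw [if_pos (by omega)]
  rw [hR]
  refine Finset.sum_congr rfl fun l hl => ?_
  have hl' : l ≤ n / 2 := Nat.lt_succ_iff.mp (Finset.mem_range.mp hl)
  have key := sum_legendre b (n - 2 * l) l
  rw [show n - 2 * l + 2 * l = n by omega] at key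
  rw [← Finset.sum_mul, ← Finset.sum_mul, key, Finset.sum_mul, Finset.sum_mul]
  refine Finset.sum_congr rfl fun j hj => ?_
  have hj' : j ≤ l := Nat.lt_succ_iff.mp (Finset.mem_range.mp hj)
  rw [balancedCorner, if_pos (even_two_mul l), show 2 * l / 2 = l by omega, legendreCoeff,
    show l - j + j = l by omega]
  simp only [map_mul, map_natCast]
  ring

/-- The numbers of loops of length `2n`, weighted by the numbers of steps of both kinds. -/
lemma sum_eval_one_loopPoly (x y : R) (n : ℕ) :
    ∑ p ∈ Finset.HasAntidiagonal.antidiagonal n,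
      Polynomial.aeval (1 : R) (loopPoly p.1 p.2) * (x ^ p.1 * y ^ p.2) =
    ((2 * n).choose n : R) * ∑ h ∈ Finset.range (n + 1),
      (n.choose h : R) * (x + y) ^ h * balancedCorner x y (n - h) := by
  rw [sum_aeval_loopPoly, balancedPart_wordSum, Finset.sum_eq_single 0]
  · simp
  · intro k _ hk
    rw [sub_self, zero_pow hk]
    simp
  · intro h
    exact absurd (Finset.mem_range.mpr (by omega)) h

end

end SquareWalk

namespace SquareWalk

/-! ### Coefficientwise summation of power series in x, y and b. -/

/-- Power series with rational coefficients in three variables. -/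
abbrev Ser := MvPowerSeries (Fin 3) ℚ

section Summation

/-- If only finitely many terms have order bound at most N, each coefficient is a finite sum. All
convergence over `Ser` rests on such order bounds. -/
lemma summable_of_le_order {ι : Type*} {f : ι → Ser} (w : ι → ℕ)
    (hf : ∀ i, (w i : ℕ∞) ≤ (f i).order) (hw : ∀ N, {i | w i ≤ N}.Finite) : Summable f := by
  refine MvPowerSeries.WithPiTopology.summable_iff_summable_coeff.mpr fun d => ?_
  refine summable_of_hasFiniteSupport ((hw d.degree).subset fun i hi => ?_)
  by_contra h
  refine hi (MvPowerSeries.coeff_of_lt_order (lt_of_lt_of_le ?_ (hf i)))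
  exact_mod_cast not_le.mp h

lemma le_order_mul_of_le {m n : ℕ} {f g : Ser} (hf : (m : ℕ∞) ≤ f.order) (hg : (n : ℕ∞) ≤ g.order) :
    ((m + n : ℕ) : ℕ∞) ≤ (f * g).order := by
  push_cast
  exact (add_le_add hf hg).trans MvPowerSeries.le_order_mul

lemma le_order_mul_right {m : ℕ} {f : Ser} (g : Ser) (hf : (m : ℕ∞) ≤ f.order) :
    (m : ℕ∞) ≤ (f * g).order :=
  le_order_mul_of_le hf (n := 0) (by simp)

lemma le_order_smul_of_le {m : ℕ} {f : Ser} (r : ℚ) (hf : (m : ℕ∞) ≤ f.order) :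
    (m : ℕ∞) ≤ (r • f).order :=
  hf.trans MvPowerSeries.le_order_smul

lemma le_order_pow {f : Ser} (hf : f.constantCoeff = 0) (n : ℕ) : (n : ℕ∞) ≤ (f ^ n).order :=
  MvPowerSeries.le_order_pow_of_constantCoeff_eq_zero n hf

lemma finite_add_le (N : ℕ) : {p : ℕ × ℕ | p.1 + p.2 ≤ N}.Finite :=
  ((Set.finite_Iic N).prod (Set.finite_Iic N)).subset fun p hp => by
    have hp' : p.1 + p.2 ≤ N := hp
    exact ⟨Set.mem_Iic.mpr (by omega), Set.mem_Iic.mpr (by omega)⟩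

lemma hasSum_of_eq {ι M : Type*} [AddCommMonoid M] [TopologicalSpace M] {f g : ι → M} {s : M}
    (hf : HasSum f s) (h : ∀ i, f i = g i) : HasSum g s :=
  funext h ▸ hf

variable {M : Type*} [AddCommMonoid M] [TopologicalSpace M] [ContinuousAdd M] [RegularSpace M]

lemma hasSum_antidiagonal_prod {κ : Type*} {f : (ℕ × ℕ) × κ → M} {s : M} (hf : HasSum f s) :
    HasSum (fun p : ℕ × κ => ∑ i ∈ Finset.range (p.1 + 1), f ((i, p.1 - i), p.2)) s := by
  let e : (Σ p : ℕ × κ, Finset.HasAntidiagonal.antidiagonal p.1) ≃ (ℕ × ℕ) × κ :=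
    { toFun := fun z => (z.2.1, z.1.2)
      invFun := fun z => ⟨(z.1.1 + z.1.2, z.2), ⟨z.1, by simp⟩⟩
      left_inv := by
        rintro ⟨⟨n, k⟩, ⟨⟨i, j⟩, h⟩⟩
        obtain rfl : i + j = n := by simpa using h
        rfl
      right_inv := fun z => rfl }
  have h := ((Equiv.hasSum_iff e).mpr hf).sigma
    (g := fun p => ∑ i ∈ Finset.range (p.1 + 1), f ((i, p.1 - i), p.2)) ?_
  · exact h
  · rintro ⟨n, k⟩
    have h1 := hasSum_fintype
      (fun c : Finset.HasAntidiagonal.antidiagonal n => f (c.1, k))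
    rw [Finset.sum_coe_sort (Finset.HasAntidiagonal.antidiagonal n) (fun c => f (c, k)),
      Finset.Nat.sum_antidiagonal_eq_sum_range_succ_mk] at h1
    exact h1

lemma hasSum_antidiagonal {f : ℕ × ℕ → M} {s : M} (hf : HasSum f s) :
    HasSum (fun n => ∑ i ∈ Finset.range (n + 1), f (i, n - i)) s := by
  have h := (Equiv.hasSum_iff Finset.HasAntidiagonal.sigmaAntidiagonalEquivProd).mpr hf |>.sigma
    (g := fun n => ∑ i ∈ Finset.range (n + 1), f (i, n - i)) ?_
  · exact h
  · intro n
    have h1 := hasSum_fintype (fun c : Finset.HasAntidiagonal.antidiagonal n => f c.1)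
    rw [Finset.sum_coe_sort (Finset.HasAntidiagonal.antidiagonal n) f,
      Finset.Nat.sum_antidiagonal_eq_sum_range_succ_mk] at h1
    exact h1

lemma hasSum_antidiagonal_antidiagonal {f : (ℕ × ℕ) × (ℕ × ℕ) → M} {s : M} (hf : HasSum f s) :
    HasSum (fun p : ℕ × ℕ => ∑ i ∈ Finset.range (p.1 + 1), ∑ j ∈ Finset.range (p.2 + 1),
      f ((i, p.1 - i), (j, p.2 - j))) s := by
  have h1 := (Equiv.hasSum_iff (Equiv.prodComm (ℕ × ℕ) ℕ)).mpr (hasSum_antidiagonal_prod hf)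
  have h2 := (Equiv.hasSum_iff (Equiv.prodComm ℕ ℕ)).mpr (hasSum_antidiagonal_prod h1)
  convert h2 using 1
  funext p
  exact Finset.sum_comm

end Summation

/-! ### Half-integer powers of 1 - Y. -/

section HalfPow

/-- `halfPow k Y` is `(1/2)(3/2)⋯(k - 1/2) (1 - Y)^(-1/2 - k)`. -/
noncomputable def halfPow (k : ℕ) (Y : Ser) : Ser :=
  ∑' s : ℕ, (halfRising (k + s) / s.factorial) • Y ^ s

variable {Y N y : Ser}

lemma hasSum_halfPow (hY : Y.constantCoeff = 0) (k : ℕ) :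
    HasSum (fun s : ℕ => (halfRising (k + s) / s.factorial : ℚ) • Y ^ s) (halfPow k Y) :=
  (summable_of_le_order (fun s => s) (fun s => le_order_smul_of_le _ (le_order_pow hY s))
    fun N => Set.finite_Iic N).hasSum

lemma constantCoeff_halfPow (hY : Y.constantCoeff = 0) (k : ℕ) :
    (halfPow k Y).constantCoeff = halfRising k := by
  have h := MvPowerSeries.WithPiTopology.hasSum_iff_hasSum_coeff.mp (hasSum_halfPow hY k) 0
  have h2 := hasSum_single (f := fun s : ℕ => MvPowerSeries.coeff 0
    ((halfRising (k + s) / s.factorial : ℚ) • Y ^ s)) 0 fun s hs => by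
      simp [hY, hs]
  have := h.unique h2
  simpa using this

/-- The normalization by the rising factorial makes passing from k to k + 1 a differentiation in Y,
whence the factor k + 1/2. -/
lemma one_sub_mul_halfPow_succ (hY : Y.constantCoeff = 0) (k : ℕ) :
    (1 - Y) * halfPow (k + 1) Y = (k + 1 / 2 : ℚ) • halfPow k Y := by
  have h := hasSum_halfPow hY (k + 1)
  have h1 : HasSum (fun s : ℕ => ((s : ℚ) * halfRising (k + s) / s.factorial) • Y ^ s)
      (Y * halfPow (k + 1) Y) := by
    rw [← hasSum_nat_add_iff' 1]
    simp only [Finset.range_one, Finset.sum_singleton, Nat.cast_zero, zero_mul, zero_div, zero_smul,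
      sub_zero]
    refine hasSum_of_eq (h.mul_left Y) fun s => ?_
    rw [mul_smul_comm, ← pow_succ', Nat.factorial_succ, show k + (s + 1) = k + 1 + s by ring]
    congr 1
    have : (s.factorial : ℚ) ≠ 0 := by positivity
    push_cast
    field_simp
  have h2 : HasSum (fun s : ℕ => (halfRising (k + 1 + s) / s.factorial : ℚ) • Y ^ s -
      ((s : ℚ) * halfRising (k + s) / s.factorial) • Y ^ s) ((k + 1 / 2 : ℚ) • halfPow k Y) := by
    refine hasSum_of_eq ((hasSum_halfPow hY k).const_smul (k + 1 / 2 : ℚ)) fun s => ?_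
    rw [← sub_smul, smul_smul, show k + 1 + s = k + s + 1 by ring, halfRising_succ]
    congr 1
    push_cast
    ring
  rw [sub_mul, one_mul, (h.sub h1).unique h2]

/-- Used to absorb the powers of 1 - N in the quadratic transformation. -/
lemma one_sub_pow_mul_halfPow (hY : Y.constantCoeff = 0) (m i : ℕ) :
    (1 - Y) ^ i * halfPow (m + i) Y = (halfRising (m + i) / halfRising m) • halfPow m Y := by
  induction i with
  | zero => simp [halfRising_ne_zero]
  | succ i ih =>
    rw [pow_succ, mul_assoc, show m + (i + 1) = m + i + 1 by ring, one_sub_mul_halfPow_succ hY,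
      mul_smul_comm, ih, smul_smul, halfRising_succ]
    congr 1
    push_cast
    ring

lemma halfPow_zero_sq (hY : Y.constantCoeff = 0) : halfPow 0 Y ^ 2 * (1 - Y) = 1 := by
  have h := hasSum_halfPow hY 0
  have hsum : Summable fun p : ℕ × ℕ => ((halfRising (0 + p.1) / p.1.factorial : ℚ) • Y ^ p.1) *
      ((halfRising (0 + p.2) / p.2.factorial : ℚ) • Y ^ p.2) :=
    summable_of_le_order (fun p => p.1 + p.2) (fun p => le_order_mul_of_le
      (le_order_smul_of_le _ (le_order_pow hY _)) (le_order_smul_of_le _ (le_order_pow hY _)))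
      finite_add_le
  have h1 := hasSum_antidiagonal (h.mul h hsum)
  have h2 : (fun n => ∑ i ∈ Finset.range (n + 1),
      ((halfRising (0 + i) / i.factorial : ℚ) • Y ^ i) *
      ((halfRising (0 + (n - i)) / (n - i).factorial : ℚ) • Y ^ (n - i))) = fun n => Y ^ n := by
    funext n
    have h3 : ∀ i ∈ Finset.range (n + 1), ((halfRising (0 + i) / i.factorial : ℚ) • Y ^ i) *
      ((halfRising (0 + (n - i)) / (n - i).factorial : ℚ) • Y ^ (n - i)) =
      (((n.choose i : ℚ) * (halfRising i * halfRising (n - i))) / n.factorial) • Y ^ n := by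
      intro i hi
      have hi' : i ≤ n := Nat.lt_succ_iff.mp (Finset.mem_range.mp hi)
      rw [smul_mul_smul_comm, ← pow_add, Nat.add_sub_cancel' hi', Nat.cast_choose ℚ hi', zero_add,
        zero_add]
      congr 1
      have : (n.factorial : ℚ) ≠ 0 := by positivity
      field_simp
    rw [Finset.sum_congr rfl h3, ← Finset.sum_smul, ← Finset.sum_div, sum_halfRising_mul_halfRising,
      div_self (by positivity), one_smul]
  rw [h2] at h1
  rw [pow_two, ← h1.tsum_eq]
  exact MvPowerSeries.WithPiTopology.tsum_pow_mul_one_sub_of_constantCoeff_eq_zero hY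

/-- Taylor expansion of `halfPow`. -/
lemma hasSum_halfPow_add (hN : N.constantCoeff = 0) (hy : y.constantCoeff = 0) (k : ℕ) :
    HasSum (fun s : ℕ => (1 / s.factorial : ℚ) • (y ^ s * halfPow (k + s) N))
      (halfPow k (y + N)) := by
  have hsum : Summable fun p : ℕ × ℕ =>
      (halfRising (k + (p.1 + p.2)) / (p.1.factorial * p.2.factorial) : ℚ) •
        (y ^ p.1 * N ^ p.2) :=
    summable_of_le_order (fun p => p.1 + p.2) (fun p => le_order_smul_of_le _ (le_order_mul_of_le
      (le_order_pow hy _) (le_order_pow hN _))) finite_add_le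
  have h1 := hasSum_antidiagonal hsum.hasSum
  have h2 := hasSum_halfPow (Y := y + N) (by simp [hN, hy]) k
  have h3 : (fun n => ∑ i ∈ Finset.range (n + 1),
      (halfRising (k + (i + (n - i))) / (i.factorial * (n - i).factorial) : ℚ) •
        (y ^ i * N ^ (n - i))) = fun n => (halfRising (k + n) / n.factorial : ℚ) • (y + N) ^ n := by
    funext n
    rw [add_pow, Finset.smul_sum]
    refine Finset.sum_congr rfl fun i hi => ?_
    have hi' : i ≤ n := Nat.lt_succ_iff.mp (Finset.mem_range.mp hi)
    have hc : ((n.choose i : ℕ) : Ser) = algebraMap ℚ Ser (n.choose i) := by simp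
    rw [hc, mul_comm _ (algebraMap ℚ Ser _), ← Algebra.smul_def, smul_smul,
      Nat.add_sub_cancel' hi', Nat.cast_choose ℚ hi']
    congr 1
    have : (n.factorial : ℚ) ≠ 0 := by positivity
    field_simp
  rw [h3] at h1
  have h4 := hsum.hasSum.prod_fiberwise
    (g := fun s => (1 / s.factorial : ℚ) • (y ^ s * halfPow (k + s) N)) fun s => by
      refine hasSum_of_eq (((hasSum_halfPow hN (k + s)).mul_left (y ^ s)).const_smul
        (1 / s.factorial : ℚ)) fun t => ?_
      rw [mul_smul_comm, smul_smul, add_assoc]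
      congr 1
      field_simp
  -- The same double series is summed along antidiagonals (binomial theorem) and along rows (Taylor
  -- terms).
  rwa [h1.unique h2] at h4

/-- Power series over ℚ form a domain, so a square root is determined up to sign, and the constant
term fixes the sign. -/
lemma eq_of_sq_mul_eq_one {f g u : Ser} (hf : f ^ 2 * u = 1) (hg : g ^ 2 * u = 1)
    (hf0 : f.constantCoeff = 1) (hg0 : g.constantCoeff = 1) : f = g := by
  have hu : u ≠ 0 := by rintro rfl; simp at hf
  have h : f ^ 2 = g ^ 2 := mul_right_cancel₀ hu (hf.trans hg.symm)
  rcases sq_eq_sq_iff_eq_or_eq_neg.mp h with h | h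
  · exact h
  · rw [h, map_neg, hg0] at hf0
    norm_num at hf0

/-- Multiplicativity of half-integer powers, with p in the role of P^(-1/2): uniqueness of the
square root settles k = 0, and the contiguous relation carries it upward. -/
lemma halfPow_eq_of_one_sub_eq {Y' P p : Ser} (hY : Y.constantCoeff = 0)
    (hY' : Y'.constantCoeff = 0) (hp : p ^ 2 * P = 1) (hp0 : p.constantCoeff = 1)
    (h : 1 - Y = P * (1 - Y')) (k : ℕ) : halfPow k Y = p ^ (2 * k + 1) * halfPow k Y' := by
  induction k with
  | zero =>
    refine eq_of_sq_mul_eq_one (halfPow_zero_sq hY) ?_ ?_ ?_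
    · rw [h]
      linear_combination halfPow 0 Y' ^ 2 * (1 - Y') * hp + halfPow_zero_sq hY'
    · simp [constantCoeff_halfPow hY]
    · simp [constantCoeff_halfPow hY', hp0]
  | succ k ih =>
    have hne : (1 - Y) ≠ 0 := by
      intro h0
      have := congrArg MvPowerSeries.constantCoeff h0
      simp [hY] at this
    refine mul_left_cancel₀ hne ?_
    rw [one_sub_mul_halfPow_succ hY, ih, ← mul_smul_comm, ← one_sub_mul_halfPow_succ hY', h]
    linear_combination -(p ^ (2 * k + 1) * ((1 - Y') * halfPow (k + 1) Y')) * hp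

end HalfPow

/-! ### Arcsine averages and the quadratic transformation. -/

section Landen

/-- `∫ (1 - κU - (1 - κ)W)^(-1/2)` with respect to the arcsine distribution. -/
noncomputable def arcsineSeries (U W : Ser) : Ser :=
  ∑' p : ℕ × ℕ, (halfRising (p.1 + p.2) * arcsineMoment p.1 p.2 /
    (p.1.factorial * p.2.factorial) : ℚ) • (U ^ p.1 * W ^ p.2)

lemma hasSum_arcsineSeries {U W : Ser} (hU : U.constantCoeff = 0) (hW : W.constantCoeff = 0) :
    HasSum (fun p : ℕ × ℕ => (halfRising (p.1 + p.2) * arcsineMoment p.1 p.2 /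
      (p.1.factorial * p.2.factorial) : ℚ) • (U ^ p.1 * W ^ p.2)) (arcsineSeries U W) := by
  have h : Summable fun p : ℕ × ℕ => (halfRising (p.1 + p.2) * arcsineMoment p.1 p.2 /
      (p.1.factorial * p.2.factorial) : ℚ) • (U ^ p.1 * W ^ p.2) :=
    summable_of_le_order (fun p => p.1 + p.2) (fun p => le_order_smul_of_le _ (le_order_mul_of_le
      (le_order_pow hU _) (le_order_pow hW _))) finite_add_le
  unfold arcsineSeries
  exact h.hasSum

lemma add_pow_eq_smul_sum (u v : Ser) (n : ℕ) : (u + v) ^ n = ∑ i ∈ Finset.range (n + 1),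
    (n.factorial / (i.factorial * (n - i).factorial) : ℚ) • (u ^ i * v ^ (n - i)) := by
  rw [add_pow]
  refine Finset.sum_congr rfl fun i hi => ?_
  have hi' : i ≤ n := Nat.lt_succ_iff.mp (Finset.mem_range.mp hi)
  rw [← Nat.cast_choose ℚ hi', Algebra.smul_def, map_natCast, mul_comm]

end Landen
end SquareWalk

namespace SquareWalk

section Landen

variable {N D c : Ser}

lemma hasSum_halfPow_add_add {u v : Ser} (hN : N.constantCoeff = 0) (hu : u.constantCoeff = 0)
    (hv : v.constantCoeff = 0) (k : ℕ) :
    HasSum (fun p : ℕ × ℕ => (1 / (p.1.factorial * p.2.factorial) : ℚ) •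
      (u ^ p.1 * v ^ p.2 * halfPow (k + p.1 + p.2) N)) (halfPow k (u + (v + N))) := by
  have hsum : Summable fun p : ℕ × ℕ => (1 / (p.1.factorial * p.2.factorial) : ℚ) •
      (u ^ p.1 * v ^ p.2 * halfPow (k + p.1 + p.2) N) :=
    summable_of_le_order (fun p => p.1 + p.2) (fun p => le_order_smul_of_le _
      (le_order_mul_right _ (le_order_mul_of_le (le_order_pow hu _) (le_order_pow hv _))))
      finite_add_le
  have h := hsum.hasSum.prod_fiberwise
    (g := fun s => (1 / s.factorial : ℚ) • (u ^ s * halfPow (k + s) (v + N))) fun s => by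
      refine hasSum_of_eq (((hasSum_halfPow_add hN hv (k + s)).mul_left (u ^ s)).const_smul
        (1 / s.factorial : ℚ)) fun t => ?_
      rw [mul_smul_comm, smul_smul, mul_assoc]
      congr 1
      field_simp
  have h2 := hasSum_halfPow_add (N := v + N) (y := u) (by simp [hN, hv]) hu k
  have h3 := hsum.hasSum
  rwa [h.unique h2] at h3

lemma summable_prod_pow {a b : Ser} (ha : a.constantCoeff = 0) (hb : b.constantCoeff = 0)
    {u v : Ser} (hu : u.constantCoeff = 0) (hv : v.constantCoeff = 0)
    (r : (ℕ × ℕ) × (ℕ × ℕ) → ℚ) (f : (ℕ × ℕ) × (ℕ × ℕ) → Ser) :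
    Summable fun z : (ℕ × ℕ) × (ℕ × ℕ) =>
      r z • (a ^ z.1.1 * b ^ z.1.2 * (u ^ z.2.1 * v ^ z.2.2) * f z) := by
  refine summable_of_le_order (fun z => z.1.1 + z.1.2 + (z.2.1 + z.2.2)) (fun z =>
    le_order_smul_of_le _ (le_order_mul_right _ (le_order_mul_of_le
      (le_order_mul_of_le (le_order_pow ha _) (le_order_pow hb _))
      (le_order_mul_of_le (le_order_pow hu _) (le_order_pow hv _))))) fun N => ?_
  refine ((finite_add_le N).prod (finite_add_le N)).subset fun z hz => ?_
  have hz' : z.1.1 + z.1.2 + (z.2.1 + z.2.2) ≤ N := hz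
  exact ⟨show z.1.1 + z.1.2 ≤ N by omega, show z.2.1 + z.2.2 ≤ N by omega⟩

lemma hasSum_prodProdProdComm {f : (ℕ × ℕ) × (ℕ × ℕ) → Ser} {g : ℕ × ℕ → Ser} {s : Ser}
    (hf : HasSum f s) (hg : ∀ p : ℕ × ℕ, HasSum (fun q : ℕ × ℕ => f ((p.1, q.1), (p.2, q.2))) (g p)) :
    HasSum g s :=
  ((Equiv.hasSum_iff (Equiv.prodProdProdComm ℕ ℕ ℕ ℕ)).mpr hf).prod_fiberwise hg

lemma sum_sum_smul (m n : ℕ) (r : ℕ → ℕ → ℚ) (f : Ser) :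
    ∑ i ∈ Finset.range m, ∑ j ∈ Finset.range n, r i j • f =
      (∑ i ∈ Finset.range m, ∑ j ∈ Finset.range n, r i j) • f := by
  simp only [Finset.sum_smul]

/-- Since κ(D + N) + (1-κ)(c + N) = N + κD + (1-κ)c, this is the Taylor expansion at N under the
integral. -/
lemma hasSum_arcsineSeries_add (hN : N.constantCoeff = 0) (hD : D.constantCoeff = 0)
    (hc : c.constantCoeff = 0) :
    HasSum (fun p : ℕ × ℕ => (arcsineMoment p.1 p.2 / (p.1.factorial * p.2.factorial) : ℚ) •
      (D ^ p.1 * c ^ p.2 * halfPow (p.1 + p.2) N)) (arcsineSeries (D + N) (c + N)) := by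
  have hs := summable_prod_pow hD hN hc hN (fun z : (ℕ × ℕ) × (ℕ × ℕ) =>
    (halfRising (z.1.1 + z.1.2 + (z.2.1 + z.2.2)) *
      arcsineMoment (z.1.1 + z.1.2) (z.2.1 + z.2.2) / (z.1.1.factorial * z.1.2.factorial *
      (z.2.1.factorial * z.2.2.factorial)) : ℚ)) 1
  have h1 := hasSum_antidiagonal_antidiagonal hs.hasSum
  have h2 := hasSum_arcsineSeries (U := D + N) (W := c + N) (by simp [hD, hN]) (by simp [hc, hN])
  have h3 := hs.hasSum
  rw [h1.unique (hasSum_of_eq h2 fun p => ?_)] at h3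
  · refine hasSum_prodProdProdComm h3 fun p => ?_
    have h4 : Summable fun q : ℕ × ℕ => (halfRising (p.1 + p.2 + (q.1 + q.2)) *
      arcsineMoment (p.1 + q.1) (p.2 + q.2) / (q.1.factorial * q.2.factorial) : ℚ) •
        (N ^ q.1 * N ^ q.2) :=
      summable_of_le_order (fun p => p.1 + p.2) (fun p => le_order_smul_of_le _
        (le_order_mul_of_le (le_order_pow hN _) (le_order_pow hN _))) finite_add_le
    have h5 := hasSum_antidiagonal h4.hasSum
    have h6 := (hasSum_halfPow hN (p.1 + p.2)).const_smul (arcsineMoment p.1 p.2)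
    have h7 := h4.hasSum
    rw [h5.unique (hasSum_of_eq h6 fun s => ?_)] at h7
    · have h8 := (h7.mul_left (D ^ p.1 * c ^ p.2)).const_smul
        (1 / (p.1.factorial * p.2.factorial) : ℚ)
      rw [mul_smul_comm, smul_smul, one_div_mul_eq_div] at h8
      refine hasSum_of_eq h8 fun q => ?_
      rw [mul_smul_comm, smul_smul, Pi.one_apply, mul_one,
        show D ^ p.1 * N ^ q.1 * (c ^ p.2 * N ^ q.2) = D ^ p.1 * c ^ p.2 * (N ^ q.1 * N ^ q.2) by ring,
        show p.1 + q.1 + (p.2 + q.2) = p.1 + p.2 + (q.1 + q.2) by ring]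
      congr 1
      field_simp
    · have h9 : ∀ i ∈ Finset.range (s + 1), (halfRising (p.1 + p.2 + (i + (s - i))) *
          arcsineMoment (p.1 + i) (p.2 + (s - i)) / (i.factorial * (s - i).factorial) : ℚ) •
          (N ^ i * N ^ (s - i)) = (halfRising (p.1 + p.2 + s) / s.factorial *
            ((s.choose i : ℚ) * arcsineMoment (p.1 + i) (p.2 + (s - i)))) • N ^ s := by
        intro i hi
        have hi' : i ≤ s := Nat.lt_succ_iff.mp (Finset.mem_range.mp hi)
        rw [← pow_add, Nat.add_sub_cancel' hi', Nat.cast_choose ℚ hi']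
        congr 1
        have : (s.factorial : ℚ) ≠ 0 := by positivity
        field_simp
      rw [Finset.sum_congr rfl h9, ← Finset.sum_smul, ← Finset.mul_sum,
        sum_choose_mul_arcsineMoment, smul_smul, mul_comm]
  · rw [add_pow_eq_smul_sum, add_pow_eq_smul_sum, Finset.sum_mul_sum, Finset.smul_sum]
    refine Finset.sum_congr rfl fun i hi => ?_
    rw [Finset.smul_sum]
    refine Finset.sum_congr rfl fun j hj => ?_
    have hi' : i ≤ p.1 := Nat.lt_succ_iff.mp (Finset.mem_range.mp hi)
    have hj' : j ≤ p.2 := Nat.lt_succ_iff.mp (Finset.mem_range.mp hj)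
    simp only [Pi.one_apply, mul_one]
    rw [Nat.add_sub_cancel' hi', Nat.add_sub_cancel' hj', smul_mul_smul_comm, smul_smul]
    congr 1
    have : (p.1.factorial : ℚ) ≠ 0 := by positivity
    have : (p.2.factorial : ℚ) ≠ 0 := by positivity
    field_simp

/-- A quadratic transformation of the Legendre type. -/
lemma hasSum_quadratic_transformation (hN : N.constantCoeff = 0) (hD : D.constantCoeff = 0)
    (hc : c.constantCoeff = 0) :
    HasSum (fun p : ℕ × ℕ => (((2 * (p.1 + p.2)).choose (p.1 + p.2) : ℚ) * (-1 / 4) ^ p.2 /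
        ((2 * p.1).factorial * p.2.factorial)) •
      ((D * (1 - N)) ^ p.1 * c ^ p.2 * halfPow (2 * p.1 + p.2) (-D + (c + N))))
      (arcsineSeries (D + N) (c + N)) := by
  have hD' : (-D).constantCoeff = 0 := by simp [hD]
  have hs := summable_prod_pow hD hD' hc hc (fun z : (ℕ × ℕ) × (ℕ × ℕ) =>
    (((2 * (z.1.1 + z.2.1)).choose (z.1.1 + z.2.1) : ℚ) * (-1 / 4) ^ z.2.1 /
      ((2 * z.1.1).factorial * z.2.1.factorial) / (z.1.2.factorial * z.2.2.factorial)))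
    (fun z => (1 - N) ^ z.1.1 * halfPow (2 * z.1.1 + z.2.1 + z.1.2 + z.2.2) N)
  have h1 := hasSum_antidiagonal_antidiagonal hs.hasSum
  have h3 := hs.hasSum
  rw [h1.unique (hasSum_of_eq (hasSum_arcsineSeries_add hN hD hc) fun p => ?_)] at h3
  · refine hasSum_prodProdProdComm h3 fun p => ?_
    have h4 := ((hasSum_halfPow_add_add hN hD' hc (2 * p.1 + p.2)).mul_left
      ((D * (1 - N)) ^ p.1 * c ^ p.2)).const_smul (((2 * (p.1 + p.2)).choose (p.1 + p.2) : ℚ) *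
        (-1 / 4) ^ p.2 / ((2 * p.1).factorial * p.2.factorial))
    refine hasSum_of_eq h4 fun q => ?_
    rw [mul_smul_comm, smul_smul, mul_one_div, mul_pow]
    congr 1
    ring
  -- Both sides are Taylor-expanded at N. Once the powers of 1 - N are absorbed, every contribution
  -- to D^p c^q carries the same half-power of 1 - N, leaving the rational identity
  -- `sum_sum_halfRising`.
  · have h5 : ∀ i ∈ Finset.range (p.1 + 1), ∀ j ∈ Finset.range (p.2 + 1),
        (((2 * (i + j)).choose (i + j) : ℚ) * (-1 / 4) ^ j /
          ((2 * i).factorial * j.factorial) / ((p.1 - i).factorial * (p.2 - j).factorial)) •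
          (D ^ i * (-D) ^ (p.1 - i) * (c ^ j * c ^ (p.2 - j)) *
            ((1 - N) ^ i * halfPow (2 * i + j + (p.1 - i) + (p.2 - j)) N)) =
        (((2 * (i + j)).choose (i + j) : ℚ) * (-1 / 4) ^ j * (-1) ^ (p.1 - i) *
          halfRising (p.1 + p.2 + i) / (halfRising (p.1 + p.2) * (2 * i).factorial * j.factorial *
          (p.1 - i).factorial * (p.2 - j).factorial)) •
          (D ^ p.1 * c ^ p.2 * halfPow (p.1 + p.2) N) := by
      intro i hi j hj
      have hi' : i ≤ p.1 := Nat.lt_succ_iff.mp (Finset.mem_range.mp hi)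
      have hj' : j ≤ p.2 := Nat.lt_succ_iff.mp (Finset.mem_range.mp hj)
      have e1 : D ^ i * (-D) ^ (p.1 - i) = ((-1) ^ (p.1 - i) : ℚ) • D ^ p.1 := by
        rw [neg_pow D, Algebra.smul_def, map_pow, map_neg, map_one]
        nth_rewrite 4 [← Nat.add_sub_cancel' hi']
        rw [pow_add]
        ring
      rw [show 2 * i + j + (p.1 - i) + (p.2 - j) = p.1 + p.2 + i by omega,
        one_sub_pow_mul_halfPow hN, e1, ← pow_add, Nat.add_sub_cancel' hj', smul_mul_assoc,
        smul_mul_smul_comm, smul_smul]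
      congr 1
      field_simp
    rw [Finset.sum_congr rfl fun i hi => Finset.sum_congr rfl (h5 i hi), sum_sum_smul,
      sum_sum_halfRising, arcsineMoment]
    congr 1
    field_simp

end Landen
end SquareWalk

namespace SquareWalk

/-! ### The loop series as an arcsine average. -/

section LoopSum

lemma hasSum_sum_of_bijective {ι κ l M : Type*} [AddCommMonoid M] [TopologicalSpace M]
    [ContinuousAdd M] [RegularSpace M] {f : ι → M} {s : M} (hf : HasSum f s) (t : κ → Finset l)
    (φ : κ → l → ι) (hφ : Function.Bijective fun z : Σ k, t k => φ z.1 z.2) :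
    HasSum (fun k => ∑ i ∈ t k, f (φ k i)) s :=
  ((Equiv.hasSum_iff (Equiv.ofBijective _ hφ)).mpr hf).sigma fun k => by
    have h := hasSum_fintype (fun c : t k => f (φ k c))
    rwa [Finset.sum_coe_sort (t k) fun c => f (φ k c)] at h

/-- The monomial (xy)^l (x+y)^h has degree n = 2l + h; this groups such terms by n. -/
lemma bijective_halves : Function.Bijective
    fun z : Σ n : ℕ, Finset.range (n / 2 + 1) => ((z.2 : ℕ), z.1 - 2 * (z.2 : ℕ)) := by
  constructor
  · rintro ⟨n, ⟨l, hl⟩⟩ ⟨n', ⟨l', hl'⟩⟩ h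
    simp only [Finset.mem_range, Prod.mk.injEq] at hl hl' h
    exact Sigma.subtype_ext (show n = n' by omega) (show l = l' by omega)
  · rintro ⟨l, h⟩
    exact ⟨⟨2 * l + h, ⟨l, by simp; omega⟩⟩, by simp⟩

lemma aeval_eq_eval₂_intCast {R : Type*} [CommRing R] [Algebra ℤ R] (a : R) (p : ℤ[X]) :
    Polynomial.aeval a p = Polynomial.eval₂ (Int.castRingHom R) a p := by
  rw [Polynomial.aeval_def, Subsingleton.elim (algebraMap ℤ R) (Int.castRingHom R)]

variable {x y : Ser} (b : Ser)

lemma summable_loopPoly (hx : x.constantCoeff = 0) (hy : y.constantCoeff = 0) :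
    Summable fun p : ℕ × ℕ =>
      Polynomial.eval₂ (Int.castRingHom Ser) (b - 1) (loopPoly p.1 p.2) * (x ^ p.1 * y ^ p.2) := by
  refine summable_of_le_order (fun p => p.1 + p.2) (fun p => ?_) finite_add_le
  rw [mul_comm]
  exact le_order_mul_right _ (le_order_mul_of_le (le_order_pow hx _) (le_order_pow hy _))

/-- Summing `legendreCoeff` over the exponent of x + y produces the half-powers of 1 - 4(x+y);
grouping the same triple series by degree in x, y gives the loop polynomials. -/
lemma hasSum_loopPoly_halfPow (hx : x.constantCoeff = 0) (hy : y.constantCoeff = 0) {S : Ser}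
    (hS : HasSum (fun p : ℕ × ℕ => (((2 * (p.1 + p.2)).choose (p.1 + p.2) : ℚ) * 4 ^ p.1 /
        ((2 * p.1).factorial * p.2.factorial)) • (b ^ (2 * p.1) * (-(2 - b) ^ 2) ^ p.2 *
          (x * y) ^ (p.1 + p.2) * halfPow (2 * p.1 + p.2) (4 * (x + y)))) S) :
    HasSum (fun p : ℕ × ℕ =>
      Polynomial.eval₂ (Int.castRingHom Ser) (b - 1) (loopPoly p.1 p.2) * (x ^ p.1 * y ^ p.2)) S := by
  have hq : (x + y).constantCoeff = 0 := by simp [hx, hy]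
  have hxy : (x * y).constantCoeff = 0 := by simp [hx]
  have hs : Summable fun z : (ℕ × ℕ) × ℕ => legendreCoeff z.2 z.1.2 z.1.1 •
      ((x * y) ^ (z.1.1 + z.1.2) * (x + y) ^ z.2 *
        (b ^ (2 * z.1.2) * (-(2 - b) ^ 2) ^ z.1.1)) := by
    refine summable_of_le_order (fun z => z.1.1 + z.1.2 + z.2) (fun z => le_order_smul_of_le _
      (le_order_mul_right _ (le_order_mul_of_le (le_order_pow hxy _) (le_order_pow hq _))))
      fun N => ?_
    refine ((finite_add_le N).prod (Set.finite_Iic N)).subset fun z hz => ?_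
    have hz' : z.1.1 + z.1.2 + z.2 ≤ N := hz
    exact ⟨show z.1.1 + z.1.2 ≤ N by omega, show z.2 ≤ N by omega⟩
  have h1 : HasSum (fun p : ℕ × ℕ => (((2 * (p.2 + p.1)).choose (p.2 + p.1) : ℚ) * 4 ^ p.2 /
        ((2 * p.2).factorial * p.1.factorial)) • (b ^ (2 * p.2) * (-(2 - b) ^ 2) ^ p.1 *
          (x * y) ^ (p.2 + p.1) * halfPow (2 * p.2 + p.1) (4 * (x + y)))) S :=
    (Equiv.hasSum_iff (Equiv.prodComm ℕ ℕ)).mpr hS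
  have h2 := hs.hasSum.prod_fiberwise fun p => (by
    refine hasSum_of_eq (((hasSum_halfPow (Y := 4 * (x + y)) (by simp [hx, hy])
      (2 * p.2 + p.1)).mul_left (b ^ (2 * p.2) * (-(2 - b) ^ 2) ^ p.1 *
          (x * y) ^ (p.2 + p.1))).const_smul (((2 * (p.2 + p.1)).choose (p.2 + p.1) : ℚ) * 4 ^ p.2 /
        ((2 * p.2).factorial * p.1.factorial))) fun h => ?_
    have h4 : (4 * (x + y)) ^ h = ((4 : ℚ) ^ h) • (x + y) ^ h := by
      rw [mul_pow, Algebra.smul_def, map_pow, map_ofNat]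
    simp only [h4, mul_smul_comm, smul_smul]
    congr 1
    · rw [legendreCoeff, pow_add]
      field_simp
    · ring : HasSum _ ((((2 * (p.2 + p.1)).choose (p.2 + p.1) : ℚ) * 4 ^ p.2 /
        ((2 * p.2).factorial * p.1.factorial)) • (b ^ (2 * p.2) * (-(2 - b) ^ 2) ^ p.1 *
          (x * y) ^ (p.2 + p.1) * halfPow (2 * p.2 + p.1) (4 * (x + y)))))
  have h3 := hs.hasSum
  rw [h2.unique h1] at h3
  have h5 := hasSum_sum_of_bijective (hasSum_antidiagonal_prod h3)
    (fun n => Finset.range (n / 2 + 1)) (fun n l => (l, n - 2 * l)) bijective_halves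
  have h6 := (summable_loopPoly b hx hy).hasSum
  have h7 := hasSum_antidiagonal h6
  rwa [h7.unique (hasSum_of_eq h5 fun n => ?_)] at h6
  have h8 := sum_aeval_loopPoly_eq b x y n
  rw [Finset.Nat.sum_antidiagonal_eq_sum_range_succ_mk] at h8
  simp only [aeval_eq_eval₂_intCast] at h8
  refine Eq.trans ?_ h8.symm
  refine Finset.sum_congr rfl fun l _ => Finset.sum_congr rfl fun j hj => ?_
  have hj' : j ≤ l := Nat.lt_succ_iff.mp (Finset.mem_range.mp hj)
  simp only [Algebra.smul_def, Nat.add_sub_cancel' hj']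
  ring

/-- The generating function of loops as an arcsine average. -/
lemma hasSum_loopPoly_arcsineSeries {z : Ser} (hx : x.constantCoeff = 0)
    (hy : y.constantCoeff = 0) (hz : z.constantCoeff = 0) {ξ ζ ω : Ser}
    (hξ : ξ = 4 * x * halfPow 0 (4 * x) ^ 2) (hζ : ζ = 4 * y * halfPow 0 (4 * y) ^ 2)
    (hω : ω = x * halfPow 0 (4 * x) ^ 2 * (y * halfPow 0 (4 * y) ^ 2))
    (h : z = 4 * b ^ 2 * ω * (ξ + ζ + 16 * ω + 16 * b * ω) + (16 * b * ω + 4 * b ^ 2 * ω) * z +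
      z ^ 2) :
    HasSum (fun p : ℕ × ℕ =>
      Polynomial.eval₂ (Int.castRingHom Ser) (b - 1) (loopPoly p.1 p.2) * (x ^ p.1 * y ^ p.2))
      (halfPow 0 (4 * x) * halfPow 0 (4 * y) *
        arcsineSeries (4 * b ^ 2 * ω + z + (16 * b * ω + z)) (4 * (2 - b) ^ 2 * ω + (16 * b * ω + z))) := by
  refine hasSum_loopPoly_halfPow b hx hy ?_
  have hω0 : ω.constantCoeff = 0 := by simp [hω, hx]
  have hN : (16 * b * ω + z).constantCoeff = 0 := by simp [hω0, hz]
  have hD : (4 * b ^ 2 * ω + z).constantCoeff = 0 := by simp [hω0, hz]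
  have hc : (4 * (2 - b) ^ 2 * ω).constantCoeff = 0 := by simp [hω0]
  have h4x : (4 * x).constantCoeff = 0 := by simp [hx]
  have h4y : (4 * y).constantCoeff = 0 := by simp [hy]
  have hpx := halfPow_zero_sq h4x
  have hpy := halfPow_zero_sq h4y
  have hp0 : (halfPow 0 (4 * x) * halfPow 0 (4 * y)).constantCoeff = 1 := by
    simp [constantCoeff_halfPow h4x, constantCoeff_halfPow h4y]
  generalize halfPow 0 (4 * x) = px at *
  generalize halfPow 0 (4 * y) = py at *
  have hP : (px * py) ^ 2 * ((1 - 4 * x) * (1 - 4 * y)) = 1 := by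
    linear_combination py ^ 2 * (1 - 4 * y) * hpx + hpy
  have hH : (px * py) ^ 2 = 1 + ξ + ζ + 16 * ω := by
    rw [hξ, hζ, hω]
    linear_combination py ^ 2 * hpx + (1 + 4 * x * px ^ 2) * hpy
  -- The equation for z says precisely that D(1 - N) = 4b²ω/((1-4x)(1-4y)), where D = 4b²ω + z and N
  -- = 16bω + z.
  have hDN : (4 * b ^ 2 * ω + z) * (1 - (16 * b * ω + z)) = 4 * b ^ 2 * ω * (px * py) ^ 2 := by
    rw [hH]
    linear_combination h
  have hsub : 1 - 4 * (x + y) = (1 - 4 * x) * (1 - 4 * y) * (1 - 16 * ω) := by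
    rw [hω]
    linear_combination (16 * x * y) * hP
  refine hasSum_of_eq ((hasSum_quadratic_transformation hN hD hc).mul_left (px * py)) fun p => ?_
  -- With c = 4(2-b)²ω, the argument -D + c + N collapses to 16ω, free of b and z, and 1 - 16ω is 1
  -- - 4(x+y) divided by (1-4x)(1-4y).
  rw [halfPow_eq_of_one_sub_eq (by simp [hx, hy]) (by simp [hω0]) hP hp0 hsub, hDN,
    show -(4 * b ^ 2 * ω + z) + (4 * (2 - b) ^ 2 * ω + (16 * b * ω + z)) = 16 * ω by ring]
  have e1 : (-(2 - b) ^ 2) ^ p.2 = ((-1 / 4) ^ p.2 : ℚ) • (4 * (2 - b) ^ 2) ^ p.2 := by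
    rw [Algebra.smul_def, map_pow, ← mul_pow, ← mul_assoc, ← map_ofNat (algebraMap ℚ Ser) 4,
      ← map_mul]
    norm_num
  have e2 : (4 * b ^ 2 * ω * (px * py) ^ 2) ^ p.1 =
      ((4 : ℚ) ^ p.1) • (b ^ 2 * ω * (px * py) ^ 2) ^ p.1 := by
    rw [Algebra.smul_def, map_pow, ← mul_pow, map_ofNat]
    ring
  rw [e1, e2]
  simp only [mul_smul_comm, smul_mul_assoc, smul_smul]
  congr 1
  · field_simp
  · have hω' : ω = x * y * (px * py) ^ 2 := by rw [hω]; ring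
    generalize halfPow (2 * p.1 + p.2) (16 * ω) = F
    rw [mul_pow (4 * (2 - b) ^ 2) ω, hω']
    generalize (4 * (2 - b) ^ 2) ^ p.2 = G
    ring

end LoopSum
end SquareWalk

namespace SquareWalk

/-! ### Series with non-negative coefficients. -/

section Positivity

/-- All coefficients of the series are non-negative. -/
def CoeffNonneg (F : Ser) : Prop := ∀ d, 0 ≤ MvPowerSeries.coeff d F

namespace CoeffNonneg

variable {F G : Ser}

lemma add (hF : CoeffNonneg F) (hG : CoeffNonneg G) : CoeffNonneg (F + G) := fun d => by
  rw [map_add]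
  exact add_nonneg (hF d) (hG d)

lemma mul (hF : CoeffNonneg F) (hG : CoeffNonneg G) : CoeffNonneg (F * G) := fun d => by
  rw [MvPowerSeries.coeff_mul]
  exact Finset.sum_nonneg fun p _ => mul_nonneg (hF _) (hG _)

lemma smul {r : ℚ} (hr : 0 ≤ r) (hF : CoeffNonneg F) : CoeffNonneg (r • F) := fun d => by
  rw [MvPowerSeries.coeff_smul]
  exact mul_nonneg hr (hF d)

lemma one : CoeffNonneg 1 := fun d => by
  rw [MvPowerSeries.coeff_one]
  split_ifs <;> norm_num

lemma pow (hF : CoeffNonneg F) (n : ℕ) : CoeffNonneg (F ^ n) := by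
  induction n with
  | zero => simpa using one
  | succ n ih => rw [pow_succ]; exact ih.mul hF

lemma natCast (n : ℕ) : CoeffNonneg (n : Ser) := by
  have h := one.smul (r := n) (by positivity)
  rwa [Algebra.smul_def, map_natCast, mul_one] at h

lemma ofNat (n : ℕ) [n.AtLeastTwo] : CoeffNonneg (OfNat.ofNat n : Ser) := natCast n

lemma X (i : Fin 3) : CoeffNonneg (MvPowerSeries.X i) := fun d => by
  rw [MvPowerSeries.coeff_X]
  split_ifs <;> norm_num

lemma of_hasSum {ι : Type*} {f : ι → Ser} (h : HasSum f F) (hf : ∀ i, CoeffNonneg (f i)) :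
    CoeffNonneg F := fun d =>
  (MvPowerSeries.WithPiTopology.hasSum_iff_hasSum_coeff.mp h d).nonneg fun i => hf i d

lemma halfPow (hF : CoeffNonneg F) (h0 : F.constantCoeff = 0) (k : ℕ) :
    CoeffNonneg (halfPow k F) :=
  of_hasSum (hasSum_halfPow h0 k) fun s =>
    (hF.pow s).smul (div_nonneg (halfRising_pos _).le (by positivity))

lemma arcsineSeries (hF : CoeffNonneg F) (h0 : F.constantCoeff = 0) (hG : CoeffNonneg G)
    (h0' : G.constantCoeff = 0) : CoeffNonneg (arcsineSeries F G) :=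
  of_hasSum (hasSum_arcsineSeries h0 h0') fun p => ((hF.pow _).mul (hG.pow _)).smul (by
    have h1 := (halfRising_pos (p.1 + p.2)).le
    have h2 := (halfRising_pos p.1).le
    have h3 := (halfRising_pos p.2).le
    rw [arcsineMoment]
    positivity)

end CoeffNonneg

lemma sum_catalan_smul (t : Ser) (n : ℕ) : ∑ i ∈ Finset.range (n + 1),
    ((catalan i : ℚ) • t ^ i) * ((catalan (n - i) : ℚ) • t ^ (n - i)) =
      (catalan (n + 1) : ℚ) • t ^ n := by
  rw [catalan_succ', Finset.Nat.sum_antidiagonal_eq_sum_range_succ_mk, Nat.cast_sum,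
    Finset.sum_smul]
  refine Finset.sum_congr rfl fun i hi => ?_
  have hi' : i ≤ n := Nat.lt_succ_iff.mp (Finset.mem_range.mp hi)
  rw [smul_mul_smul_comm, ← pow_add, Nat.add_sub_cancel' hi', Nat.cast_mul]

lemma summable_smul_pow {t : Ser} (ht : t.constantCoeff = 0) (r : ℕ → ℚ) :
    Summable fun n => r n • t ^ n :=
  summable_of_le_order (fun n => n) (fun n => le_order_smul_of_le _ (le_order_pow ht n))
    fun N => Set.finite_Iic N

lemma hasSum_smul_pow_mul {t : Ser} (ht : t.constantCoeff = 0) {r : ℕ → ℚ} {C : Ser}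
    (h : HasSum (fun n => r n • t ^ n) C) :
    HasSum (fun n => ∑ i ∈ Finset.range (n + 1), (r i • t ^ i) * (r (n - i) • t ^ (n - i)))
      (C * C) := by
  have hsum : Summable fun p : ℕ × ℕ => (r p.1 • t ^ p.1) * (r p.2 • t ^ p.2) :=
    summable_of_le_order (fun p => p.1 + p.2) (fun p => le_order_mul_of_le
      (le_order_smul_of_le _ (le_order_pow ht _)) (le_order_smul_of_le _ (le_order_pow ht _)))
      finite_add_le
  have h1 := hasSum_antidiagonal (h.mul h hsum)
  exact h1

/-- C is the Catalan generating function evaluated at t. -/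
lemma exists_catalan {t : Ser} (ht : t.constantCoeff = 0) (hn : CoeffNonneg t) :
    ∃ C : Ser, CoeffNonneg C ∧ C = 1 + t * C ^ 2 := by
  obtain ⟨C, h⟩ := summable_smul_pow ht fun n => (catalan n : ℚ)
  refine ⟨C, .of_hasSum h fun n => (hn.pow n).smul (Nat.cast_nonneg _), ?_⟩
  have h1 := (hasSum_smul_pow_mul ht h).mul_left t
  have h2 : HasSum (fun n : ℕ => (catalan (n + 1) : ℚ) • t ^ (n + 1)) (t * (C * C)) := by
    refine hasSum_of_eq h1 fun n => ?_
    rw [sum_catalan_smul, mul_smul_comm, ← pow_succ']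
  have h3 : HasSum (fun n : ℕ => (catalan n : ℚ) • t ^ n)
      ((catalan 0 : ℚ) • t ^ 0 + t * (C * C)) := h2.zero_add
  have h4 := h.unique h3
  rwa [catalan_zero, Nat.cast_one, one_smul, pow_zero, ← pow_two] at h4

/-- With G = 1/(1 - v) and C the Catalan series at uG², the root is z = uGC, visibly non-negative.
-/
lemma exists_quadratic_root {u v : Ser} (hu0 : u.constantCoeff = 0) (hv0 : v.constantCoeff = 0)
    (hu : CoeffNonneg u) (hv : CoeffNonneg v) :
    ∃ z : Ser, z.constantCoeff = 0 ∧ CoeffNonneg z ∧ z = u + v * z + z ^ 2 := by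
  have hG := MvPowerSeries.WithPiTopology.tsum_pow_mul_one_sub_of_constantCoeff_eq_zero hv0
  have hs : Summable fun n : ℕ => v ^ n :=
    summable_of_le_order (fun n => n) (fun n => le_order_pow hv0 n) fun N => Set.finite_Iic N
  have hGn := CoeffNonneg.of_hasSum hs.hasSum fun n => hv.pow n
  generalize (∑' n : ℕ, v ^ n) = G at hG hGn
  obtain ⟨C, hC, hC2⟩ := exists_catalan (t := u * G ^ 2) (by simp [hu0]) (hu.mul (hGn.pow 2))
  refine ⟨u * G * C, by simp [hu0], (hu.mul hGn).mul hC, ?_⟩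
  linear_combination u * C * hG + u * hC2

end Positivity
end SquareWalk

namespace SquareWalk

/-! ### Reading off (a+1)-positivity. -/

section Extraction

lemma eval₂_sub_one (b : Ser) (L : ℤ[X]) : Polynomial.eval₂ (Int.castRingHom Ser) (b - 1) L =
    Polynomial.eval₂ (Int.castRingHom Ser) b (L.comp (Polynomial.X - 1)) := by
  rw [Polynomial.eval₂_comp]
  simp

lemma eq_single_add_iff (d : Fin 3 →₀ ℕ) (i j k : ℕ) :
    d = Finsupp.single 2 k + (Finsupp.single 0 i + Finsupp.single 1 j) ↔
      (d 0, d 1) = (i, j) ∧ d 2 = k := by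
  constructor
  · rintro rfl
    simp
  · rintro ⟨h, h2⟩
    ext m
    fin_cases m <;> simp_all

lemma coeff_eval₂_mul (d : Fin 3 →₀ ℕ) (Q : ℤ[X]) (i j : ℕ) :
    MvPowerSeries.coeff d (Polynomial.eval₂ (Int.castRingHom Ser) (MvPowerSeries.X 2) Q *
      (MvPowerSeries.X 0 ^ i * MvPowerSeries.X 1 ^ j)) =
    if (d 0, d 1) = (i, j) then (Q.coeff (d 2) : ℚ) else 0 := by
  induction Q using Polynomial.induction_on' with
  | add p q hp hq =>
    rw [Polynomial.eval₂_add, add_mul, map_add, hp, hq, Polynomial.coeff_add]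
    split_ifs <;> simp
  | monomial n a =>
    have h : (Int.castRingHom Ser a) = MvPowerSeries.C (a : ℚ) := by simp
    rw [Polynomial.eval₂_monomial, h, mul_assoc, MvPowerSeries.coeff_C_mul, MvPowerSeries.X_pow_eq,
      MvPowerSeries.X_pow_eq, MvPowerSeries.X_pow_eq, MvPowerSeries.monomial_mul_monomial,
      MvPowerSeries.monomial_mul_monomial, MvPowerSeries.coeff_monomial, Polynomial.coeff_monomial]
    simp only [eq_single_add_iff, one_mul]
    by_cases h1 : (d 0, d 1) = (i, j)
    · by_cases h2 : d 2 = n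
      · rw [if_pos ⟨h1, h2⟩, if_pos h1, if_pos h2.symm, mul_one]
      · rw [if_neg fun h => h2 h.2, if_pos h1, if_neg (Ne.symm h2), mul_zero, Int.cast_zero]
    · rw [if_neg fun h => h1 h.1, if_neg h1, mul_zero]

/-- The third variable stands for b = a + 1, and composing with X - 1 rewrites a polynomial in a as
one in b. -/
lemma coeff_comp_loopPoly {S : Ser} (h : HasSum (fun p : ℕ × ℕ =>
      Polynomial.eval₂ (Int.castRingHom Ser) (MvPowerSeries.X 2 - 1) (loopPoly p.1 p.2) *
        (MvPowerSeries.X 0 ^ p.1 * MvPowerSeries.X 1 ^ p.2)) S) (d : Fin 3 →₀ ℕ) :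
    MvPowerSeries.coeff d S = ((loopPoly (d 0) (d 1)).comp (Polynomial.X - 1)).coeff (d 2) := by
  have h1 := MvPowerSeries.WithPiTopology.hasSum_iff_hasSum_coeff.mp h d
  simp only [eval₂_sub_one, coeff_eval₂_mul] at h1
  refine h1.unique ?_
  have h2 := hasSum_single (f := fun p : ℕ × ℕ => if (d 0, d 1) = (p.1, p.2) then
    (((loopPoly p.1 p.2).comp (Polynomial.X - 1)).coeff (d 2) : ℚ) else 0) (d 0, d 1)
    fun p hp => if_neg fun h => hp h.symm
  simpa using h2

/-- `a + 1`-positivity of the coefficients of the generating function of loops. -/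
lemma coeff_comp_loopPoly_nonneg (i j k : ℕ) :
    0 ≤ ((loopPoly i j).comp (Polynomial.X - 1)).coeff k := by
  have key : ∃ S : Ser, CoeffNonneg S ∧ HasSum (fun p : ℕ × ℕ =>
      Polynomial.eval₂ (Int.castRingHom Ser) (MvPowerSeries.X 2 - 1) (loopPoly p.1 p.2) *
        (MvPowerSeries.X 0 ^ p.1 * MvPowerSeries.X 1 ^ p.2)) S := by
    have hx : (MvPowerSeries.X 0 : Ser).constantCoeff = 0 := by simp
    have hy : (MvPowerSeries.X 1 : Ser).constantCoeff = 0 := by simp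
    have nx := CoeffNonneg.X 0
    have ny := CoeffNonneg.X 1
    have nb := CoeffNonneg.X 2
    generalize (MvPowerSeries.X 0 : Ser) = x at *
    generalize (MvPowerSeries.X 1 : Ser) = y at *
    generalize (MvPowerSeries.X 2 : Ser) = b at *
    have n4 := CoeffNonneg.ofNat 4
    have n16 := CoeffNonneg.ofNat 16
    have n4x : CoeffNonneg (4 * x) := n4.mul nx
    have n4y : CoeffNonneg (4 * y) := n4.mul ny
    have h4x : (4 * x).constantCoeff = 0 := by simp [hx]
    have h4y : (4 * y).constantCoeff = 0 := by simp [hy]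
    have npx := n4x.halfPow h4x 0
    have npy := n4y.halfPow h4y 0
    obtain ⟨ω, hω⟩ : ∃ ω, ω = x * halfPow 0 (4 * x) ^ 2 * (y * halfPow 0 (4 * y) ^ 2) := ⟨_, rfl⟩
    have nω : CoeffNonneg ω := by
      rw [hω]
      exact (nx.mul (npx.pow 2)).mul (ny.mul (npy.pow 2))
    have hω0 : ω.constantCoeff = 0 := by simp [hω, hx]
    have n1 : CoeffNonneg (16 * b * ω) := (n16.mul nb).mul nω
    have n2 : CoeffNonneg (4 * b ^ 2 * ω) := (n4.mul (nb.pow 2)).mul nω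
    obtain ⟨z, hz0, nz, hz⟩ := exists_quadratic_root
      (u := 4 * b ^ 2 * ω * (4 * x * halfPow 0 (4 * x) ^ 2 + 4 * y * halfPow 0 (4 * y) ^ 2 +
        16 * ω + 16 * b * ω)) (v := 16 * b * ω + 4 * b ^ 2 * ω) (by simp [hω0]) (by simp [hω0])
      (n2.mul ((((n4x.mul (npx.pow 2)).add (n4y.mul (npy.pow 2))).add (n16.mul nω)).add n1))
      (n1.add n2)
    refine ⟨_, ?_, hasSum_loopPoly_arcsineSeries b hx hy hz0 rfl rfl hω hz⟩
    -- The only negative term, -16bω from (2-b)², is cancelled by the 16bω in N.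
    have hW : 4 * (2 - b) ^ 2 * ω + (16 * b * ω + z) = 16 * ω + 4 * b ^ 2 * ω + z := by ring
    rw [hW]
    exact (npx.mul npy).mul (((n2.add nz).add (n1.add nz)).arcsineSeries (by simp [hω0, hz0])
      (((n16.mul nω).add n2).add nz) (by simp [hω0, hz0]))
  obtain ⟨S, hS, h⟩ := key
  have h1 := hS (Finsupp.single 2 k + (Finsupp.single 0 i + Finsupp.single 1 j))
  rw [coeff_comp_loopPoly h] at h1
  simpa using h1

lemma exists_natPolynomial (i j : ℕ) : ∃ P : Polynomial ℕ,
    loopPoly i j = (P.map (Nat.castRingHom ℤ)).comp (Polynomial.X + 1) := by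
  have h : (loopPoly i j).comp (Polynomial.X - 1) ∈ Polynomial.lifts (Nat.castRingHom ℤ) := by
    rw [Polynomial.lifts_iff_coeff_lifts]
    intro k
    exact ⟨_, Int.toNat_of_nonneg (coeff_comp_loopPoly_nonneg i j k)⟩
  obtain ⟨P, hP⟩ := (Polynomial.mem_lifts _).mp h
  refine ⟨P, ?_⟩
  rw [hP, Polynomial.comp_assoc]
  simp

theorem isAddOnePositive_loopSeries : IsAddOnePositive loopSeries := by
  intro e
  have he : MvPowerSeries.coeff e loopSeries = cornerPoly (e 0) (e 1) (0, 0) := rfl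
  rw [he]
  by_cases h : Even (e 0) ∧ Even (e 1)
  · obtain ⟨⟨i, hi⟩, ⟨j, hj⟩⟩ := h
    rw [hi, hj, ← two_mul, ← two_mul]
    exact exists_natPolynomial i j
  · exact ⟨0, by rw [cornerPoly_eq_zero _ _ h]; simp⟩

end Extraction
end SquareWalk

namespace SquareWalk

/-! ### The values a = 1 and a = -1, and the diagonal. -/

section Specialization

lemma sum_choose_mul_choose (i j : ℕ) :
    ∑ q ∈ Finset.range (min i j + 1), i.choose q * j.choose q = (i + j).choose i := by
  rw [Nat.add_choose_eq, Finset.Nat.sum_antidiagonal_eq_sum_range_succ_mk]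
  refine Eq.trans ?_ (Finset.sum_flip fun k => i.choose k * j.choose (i - k))
  refine Finset.sum_subset_zero_on_sdiff (fun q hq => ?_) (fun q hq => ?_) fun q hq => ?_
  · simp only [Finset.mem_range] at hq ⊢
    omega
  · simp only [Finset.mem_sdiff, Finset.mem_range] at hq
    rw [Nat.choose_eq_zero_of_lt (show j < i - (i - q) by omega), mul_zero]
  · simp only [Finset.mem_range] at hq
    rw [Nat.choose_symm (by omega), Nat.sub_sub_self (by omega)]

/-- Both sides are the multinomial coefficient with parts m, m, i - m, n - i - m. -/
lemma choose_mul_choose_mul_choose {n i m : ℕ} (hi : m ≤ i) (hn : i + m ≤ n) :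
    n.choose (2 * m) * ((2 * m).choose m * (n - 2 * m).choose (i - m)) =
      n.choose i * (i.choose m * (n - i).choose m) := by
  rw [← Nat.cast_inj (R := ℚ)]
  push_cast
  rw [Nat.cast_choose ℚ (show 2 * m ≤ n by omega), Nat.cast_choose ℚ (show m ≤ 2 * m by omega),
    Nat.cast_choose ℚ (show i - m ≤ n - 2 * m by omega), Nat.cast_choose ℚ (show i ≤ n by omega),
    Nat.cast_choose ℚ hi, Nat.cast_choose ℚ (show m ≤ n - i by omega),
    show 2 * m - m = m by omega, show n - 2 * m - (i - m) = n - i - m by omega]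
  have h1 : (i.factorial : ℚ) ≠ 0 := by positivity
  have h2 : ((n - i).factorial : ℚ) ≠ 0 := by positivity
  have h3 : ((2 * m).factorial : ℚ) ≠ 0 := by positivity
  have h4 : ((n - 2 * m).factorial : ℚ) ≠ 0 := by positivity
  field_simp

lemma coeff_balancedCorner (n h i : ℕ) :
    ((((n.choose h : ℕ) : ℤ[X]) * (Polynomial.X + 1) ^ h *
      balancedCorner Polynomial.X 1 (n - h)).coeff i) =
    if Even (n - h) ∧ (n - h) / 2 ≤ i then
      ((n.choose h * ((n - h).choose ((n - h) / 2) * h.choose (i - (n - h) / 2)) : ℕ) : ℤ)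
    else 0 := by
  rw [balancedCorner]
  by_cases h1 : Even (n - h)
  · rw [if_pos h1, mul_one, mul_left_comm, ← mul_assoc, Polynomial.coeff_mul_X_pow',
      ← Polynomial.C_eq_natCast, ← Polynomial.C_eq_natCast, Polynomial.coeff_C_mul,
      Polynomial.coeff_C_mul, Polynomial.coeff_X_add_one_pow]
    by_cases h2 : (n - h) / 2 ≤ i
    · rw [if_pos h2, if_pos ⟨h1, h2⟩]
      push_cast
      ring
    · rw [if_neg h2, if_neg fun hh => h2 hh.2]
  · rw [if_neg h1, if_neg fun hh => h1 hh.1, mul_zero, Polynomial.coeff_zero]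

/-- Set y = 1 and read off the coefficient of x^i in the balanced part of σ^(2n); the remaining sum
is Vandermonde's. -/
lemma eval_one_loopPoly_of_le {n i : ℕ} (hi : i ≤ n) :
    (loopPoly i (n - i)).eval 1 = ((2 * n).choose n * n.choose i ^ 2 : ℕ) := by
  have h := congrArg (fun f : ℤ[X] => f.coeff i) (sum_eval_one_loopPoly (Polynomial.X : ℤ[X]) 1 n)
  simp only [aeval_eq_eval₂_intCast] at h
  rw [Finset.Nat.sum_antidiagonal_eq_sum_range_succ_mk] at h
  simp only [one_pow, mul_one, Polynomial.finsetSum_coeff, ← Polynomial.C_eq_natCast,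
    Polynomial.coeff_C_mul] at h
  have h1 : ∀ L : ℤ[X], Polynomial.eval₂ (Int.castRingHom ℤ[X]) 1 L = Polynomial.C (L.eval 1) := by
    intro L
    rw [Polynomial.eval_eq_sum_range, Polynomial.eval₂_eq_sum_range]
    simp
  simp only [h1, Polynomial.coeff_C_mul, Polynomial.coeff_X_pow, mul_ite, mul_one, mul_zero] at h
  rw [Finset.sum_ite_eq, if_pos (Finset.mem_range.mpr (by omega))] at h
  rw [h]
  simp only [Polynomial.C_eq_natCast]
  rw [Finset.sum_congr rfl fun k _ => coeff_balancedCorner n k i]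
  have h2 : ∑ q ∈ Finset.range (min i (n - i) + 1),
      ((n.choose i * (i.choose q * (n - i).choose q) : ℕ) : ℤ) = (n.choose i ^ 2 : ℕ) := by
    rw [← Nat.cast_sum, ← Finset.mul_sum, sum_choose_mul_choose, Nat.add_sub_cancel' hi, pow_two]
  rw [Nat.cast_mul, ← h2]
  congr 1
  symm
  refine Finset.sum_of_injOn (fun q => n - 2 * q) ?_ ?_ ?_ ?_
  · intro q hq q' hq' hqq
    simp only [Finset.coe_range, Set.mem_Iio] at hq hq' hqq
    omega
  · intro q hq
    simp only [Finset.coe_range, Set.mem_Iio] at hq ⊢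
    omega
  · intro k hk hn
    simp only [Finset.mem_range] at hk
    split_ifs with h3
    · obtain ⟨⟨m, hm⟩, h4⟩ := h3
      have h5 : ¬m < min i (n - i) + 1 := fun h5 => hn ⟨m, by simpa using h5, by simp only; omega⟩
      -- Here (n-k)/2 = m ≤ i while m > min(i, n-i), hence m > n - i and the last binomial
      -- coefficient vanishes.
      rw [Nat.choose_eq_zero_of_lt (show k < i - (n - k) / 2 by omega), mul_zero, mul_zero,
        Nat.cast_zero]
    · rfl
  · intro q hq
    simp only [Finset.mem_range] at hq
    have h3 : n - (n - 2 * q) = 2 * q := by omega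
    rw [h3, if_pos ⟨even_two_mul q, by omega⟩, Nat.mul_div_cancel_left q two_pos,
      Nat.choose_symm (show 2 * q ≤ n by omega),
      choose_mul_choose_mul_choose (show q ≤ i by omega) (show i + q ≤ n by omega)]

lemma eval_one_loopPoly (i j : ℕ) : (loopPoly i j).eval 1 =
    ((2 * i + 2 * j).choose (2 * i) * (2 * i).choose i * (2 * j).choose j : ℕ) := by
  have h := eval_one_loopPoly_of_le (Nat.le_add_right i j)
  rw [Nat.add_sub_cancel_left] at h
  rw [h, Nat.cast_inj, ← Nat.cast_inj (R := ℚ)]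
  push_cast
  rw [Nat.cast_choose ℚ (show i + j ≤ 2 * (i + j) by omega),
    Nat.cast_choose ℚ (show i ≤ i + j by omega),
    Nat.cast_choose ℚ (show 2 * i ≤ 2 * i + 2 * j by omega),
    Nat.cast_choose ℚ (show i ≤ 2 * i by omega), Nat.cast_choose ℚ (show j ≤ 2 * j by omega),
    show 2 * (i + j) - (i + j) = i + j by omega, show 2 * i - i = i by omega,
    show 2 * j - j = j by omega, Nat.add_sub_cancel_left, Nat.add_sub_cancel_left, mul_add]
  have h1 : ((i + j).factorial : ℚ) ≠ 0 := by positivity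
  have h2 : ((2 * i).factorial : ℚ) ≠ 0 := by positivity
  have h3 : ((2 * j).factorial : ℚ) ≠ 0 := by positivity
  field_simp

lemma halfPow_zero_right (k : ℕ) : halfPow k 0 = halfRising k • (1 : Ser) := by
  have h := hasSum_single (f := fun s : ℕ => (halfRising (k + s) / s.factorial : ℚ) • (0 : Ser) ^ s)
    0 fun s hs => by rw [zero_pow hs, smul_zero]
  rw [(hasSum_halfPow (Y := 0) (map_zero _) k).unique h]
  simp

lemma hasSum_arcsineSeries_zero {W : Ser} (hW : W.constantCoeff = 0) :
    HasSum (fun q : ℕ => (halfRising q ^ 2 / (q.factorial : ℚ) ^ 2) • W ^ q)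
      (arcsineSeries 0 W) := by
  have h := hasSum_arcsineSeries (U := 0) (map_zero _) hW
  have hinj : Function.Injective fun q : ℕ => ((0, q) : ℕ × ℕ) := fun a b hab => by
    simpa using hab
  have h1 := (hinj.hasSum_iff (f := fun p : ℕ × ℕ => (halfRising (p.1 + p.2) *
    arcsineMoment p.1 p.2 / (p.1.factorial * p.2.factorial) : ℚ) • ((0 : Ser) ^ p.1 * W ^ p.2))
    fun p hp => by
      have hp' : p.1 ≠ 0 := fun h0 => hp ⟨p.2, Prod.ext h0.symm rfl⟩
      rw [zero_pow hp', zero_mul, smul_zero]).mpr h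
  refine hasSum_of_eq h1 fun q => ?_
  simp only [Function.comp, zero_add, pow_zero, one_mul, arcsineMoment, halfRising_zero,
    Nat.factorial_zero, Nat.cast_one]
  congr 1
  field_simp

/-- Binomial series of x^q(1-4x)^(-1/2-q), obtained by comparing 1 - 4x with 1 - 0. -/
lemma hasSum_pow_mul_halfPow {x : Ser} (hx : x.constantCoeff = 0) (q : ℕ) :
    HasSum (fun s : ℕ => (halfRising (q + s) * 4 ^ s / s.factorial : ℚ) • x ^ (q + s))
      (halfRising q • (halfPow 0 (4 * x) * (x * halfPow 0 (4 * x) ^ 2) ^ q)) := by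
  have h4x : (4 * x).constantCoeff = 0 := by simp [hx]
  have h := (hasSum_halfPow h4x q).mul_left (x ^ q)
  rw [halfPow_eq_of_one_sub_eq h4x (map_zero _) (halfPow_zero_sq h4x)
    (by simp [constantCoeff_halfPow h4x]) (by ring) q, halfPow_zero_right] at h
  have e : x ^ q * (halfPow 0 (4 * x) ^ (2 * q + 1) * halfRising q • (1 : Ser)) =
      halfRising q • (halfPow 0 (4 * x) * (x * halfPow 0 (4 * x) ^ 2) ^ q) := by
    simp only [mul_smul_comm]
    congr 1
    ring
  rw [e] at h
  refine hasSum_of_eq h fun s => ?_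
  have h4 : (4 * x) ^ s = ((4 : ℚ) ^ s) • x ^ s := by
    rw [mul_pow, Algebra.smul_def, map_pow, map_ofNat]
  rw [h4, smul_smul, mul_smul_comm, pow_add]
  congr 1
  ring

lemma bijective_diagonal_shift : Function.Bijective
    fun z : Σ p : ℕ × ℕ, Finset.range (min p.1 p.2 + 1) =>
      ((z.2 : ℕ), (z.1.1 - (z.2 : ℕ), z.1.2 - (z.2 : ℕ))) := by
  constructor
  · rintro ⟨⟨i, j⟩, ⟨q, hq⟩⟩ ⟨⟨i', j'⟩, ⟨q', hq'⟩⟩ h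
    simp only [Finset.mem_range, Prod.mk.injEq] at hq hq' h
    exact Sigma.subtype_ext (Prod.ext (show i = i' by omega) (show j = j' by omega))
      (show q = q' by omega)
  · rintro ⟨q, s, t⟩
    exact ⟨⟨(q + s, q + t), ⟨q, by simp⟩⟩, by simp⟩

/-- The powers of 4 and 16 combine to 4^(i+j), independent of q, and Vandermonde does the rest. -/
lemma sum_halfRising_mul_four_pow (i j : ℕ) : ∑ q ∈ Finset.range (min i j + 1),
    (16 ^ q / (q.factorial : ℚ) ^ 2 * (halfRising i * 4 ^ (i - q) / (i - q).factorial *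
      (halfRising j * 4 ^ (j - q) / (j - q).factorial)) : ℚ) =
    ((i + j).choose i * (2 * i).choose i * (2 * j).choose j : ℕ) := by
  have h : ∀ q ∈ Finset.range (min i j + 1),
      (16 ^ q / (q.factorial : ℚ) ^ 2 * (halfRising i * 4 ^ (i - q) / (i - q).factorial *
      (halfRising j * 4 ^ (j - q) / (j - q).factorial))) =
      ((i.choose q * j.choose q : ℕ) : ℚ) * ((2 * i).choose i * (2 * j).choose j) := by
    intro q hq
    rw [Finset.mem_range] at hq
    have h4 : (16 : ℚ) ^ q * (4 ^ (i - q) * 4 ^ (j - q)) = 4 ^ i * 4 ^ j := by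
      rw [show (16 : ℚ) = 4 * 4 by norm_num, mul_pow]
      have hi : (4 : ℚ) ^ i = 4 ^ q * 4 ^ (i - q) := by rw [← pow_add]; congr 1; omega
      have hj : (4 : ℚ) ^ j = 4 ^ q * 4 ^ (j - q) := by rw [← pow_add]; congr 1; omega
      rw [hi, hj]
      ring
    have hi := four_pow_mul_halfRising i
    have hj := four_pow_mul_halfRising j
    push_cast
    rw [Nat.cast_choose ℚ (show q ≤ i by omega), Nat.cast_choose ℚ (show q ≤ j by omega),
      Nat.cast_choose ℚ (show i ≤ 2 * i by omega), Nat.cast_choose ℚ (show j ≤ 2 * j by omega),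
      show 2 * i - i = i by omega, show 2 * j - j = j by omega, ← hi, ← hj]
    have h1 : (i.factorial : ℚ) ≠ 0 := by positivity
    have h2 : (j.factorial : ℚ) ≠ 0 := by positivity
    field_simp
    linear_combination halfRising i * halfRising j * h4
  rw [Finset.sum_congr rfl h, ← Finset.sum_mul, ← Nat.cast_sum, sum_choose_mul_choose]
  push_cast
  ring

/-- Expand the average in powers ω^q, then each factor in x and in y; the coefficient of x^i y^j
collects q ≤ min(i, j). -/
lemma hasSum_halfPow_mul_arcsineSeries {x y : Ser} (hx : x.constantCoeff = 0)
    (hy : y.constantCoeff = 0) :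
    HasSum (fun p : ℕ × ℕ => (((p.1 + p.2).choose p.1 * (2 * p.1).choose p.1 *
      (2 * p.2).choose p.2 : ℕ) : ℚ) • (x ^ p.1 * y ^ p.2))
      (halfPow 0 (4 * x) * halfPow 0 (4 * y) *
        arcsineSeries 0 (16 * (x * halfPow 0 (4 * x) ^ 2 * (y * halfPow 0 (4 * y) ^ 2)))) := by
  have hs : Summable fun z : ℕ × (ℕ × ℕ) => (16 ^ z.1 / (z.1.factorial : ℚ) ^ 2 *
      (halfRising (z.1 + z.2.1) * 4 ^ z.2.1 / z.2.1.factorial *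
      (halfRising (z.1 + z.2.2) * 4 ^ z.2.2 / z.2.2.factorial))) •
      (x ^ (z.1 + z.2.1) * y ^ (z.1 + z.2.2)) := by
    refine summable_of_le_order (fun z => z.1 + z.2.1 + (z.1 + z.2.2)) (fun z =>
      le_order_smul_of_le _ (le_order_mul_of_le (le_order_pow hx _) (le_order_pow hy _)))
      fun N => ?_
    refine ((Set.finite_Iic N).prod (finite_add_le N)).subset fun z hz => ?_
    have hz' : z.1 + z.2.1 + (z.1 + z.2.2) ≤ N := hz
    exact ⟨show z.1 ≤ N by omega, show z.2.1 + z.2.2 ≤ N by omega⟩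
  have hW : (16 * (x * halfPow 0 (4 * x) ^ 2 * (y * halfPow 0 (4 * y) ^ 2))).constantCoeff = 0 := by
    simp [hx]
  have h1 := (hasSum_arcsineSeries_zero hW).mul_left (halfPow 0 (4 * x) * halfPow 0 (4 * y))
  have h2 := hs.hasSum.prod_fiberwise fun q => (by
    have hs2 : Summable fun p : ℕ × ℕ =>
        ((halfRising (q + p.1) * 4 ^ p.1 / p.1.factorial : ℚ) • x ^ (q + p.1)) *
        ((halfRising (q + p.2) * 4 ^ p.2 / p.2.factorial : ℚ) • y ^ (q + p.2)) := by
      refine summable_of_le_order (fun p => (q + p.1) + (q + p.2)) (fun p => le_order_mul_of_le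
        (le_order_smul_of_le _ (le_order_pow hx _)) (le_order_smul_of_le _ (le_order_pow hy _)))
        fun N => (finite_add_le N).subset fun p hp => ?_
      have hp' : (q + p.1) + (q + p.2) ≤ N := hp
      exact show p.1 + p.2 ≤ N by omega
    have h3 := ((hasSum_pow_mul_halfPow hx q).mul (hasSum_pow_mul_halfPow hy q) hs2).const_smul
      (16 ^ q / (q.factorial : ℚ) ^ 2)
    refine hasSum_of_eq h3 fun p => ?_
    rw [smul_mul_smul_comm, smul_smul] : HasSum _ ((16 ^ q / (q.factorial : ℚ) ^ 2) •
      ((halfRising q • (halfPow 0 (4 * x) * (x * halfPow 0 (4 * x) ^ 2) ^ q)) *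
        (halfRising q • (halfPow 0 (4 * y) * (y * halfPow 0 (4 * y) ^ 2) ^ q)))))
  have h3 := hs.hasSum
  rw [h2.unique (hasSum_of_eq h1 fun q => ?_)] at h3
  · refine hasSum_of_eq (hasSum_sum_of_bijective h3 (fun p => Finset.range (min p.1 p.2 + 1))
      (fun p q => (q, (p.1 - q, p.2 - q))) bijective_diagonal_shift) fun p => ?_
    rw [← sum_halfRising_mul_four_pow, Finset.sum_smul]
    refine Finset.sum_congr rfl fun q hq => ?_
    rw [Finset.mem_range] at hq
    simp only [Nat.add_sub_cancel' (show q ≤ p.1 by omega),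
      Nat.add_sub_cancel' (show q ≤ p.2 by omega)]
  · have h16 : ∀ v : Ser, (16 * v) ^ q = ((16 : ℚ) ^ q) • v ^ q := fun v => by
      rw [mul_pow, Algebra.smul_def, map_pow, map_ofNat]
    rw [h16, smul_mul_smul_comm, smul_smul, smul_smul, mul_smul_comm]
    congr 1
    · ring
    · ring

lemma coeff_of_hasSum_smul {r : ℕ × ℕ → ℚ} {S : Ser} (h : HasSum (fun p : ℕ × ℕ =>
      r p • (MvPowerSeries.X 0 ^ p.1 * MvPowerSeries.X 1 ^ p.2)) S) (i j : ℕ) :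
    MvPowerSeries.coeff (Finsupp.single 0 i + Finsupp.single 1 j) S = r (i, j) := by
  have h1 := MvPowerSeries.WithPiTopology.hasSum_iff_hasSum_coeff.mp h
    (Finsupp.single 0 i + Finsupp.single 1 j)
  have hc : ∀ p : ℕ × ℕ, MvPowerSeries.coeff (Finsupp.single 0 i + Finsupp.single 1 j)
      (r p • (MvPowerSeries.X 0 ^ p.1 * MvPowerSeries.X 1 ^ p.2) : Ser) =
      if p = (i, j) then r p else 0 := by
    intro p
    have h2 := coeff_eval₂_mul (Finsupp.single 0 i + Finsupp.single 1 j) 1 p.1 p.2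
    rw [Polynomial.eval₂_one, one_mul] at h2
    rw [MvPowerSeries.coeff_smul, h2]
    simp [eq_comm]
  simp only [hc] at h1
  have h2 := hasSum_single (f := fun p : ℕ × ℕ => if p = (i, j) then r p else 0) (i, j)
    fun p hp => if_neg hp
  simpa using h1.unique h2

/-- At b = 0 the quadratic for z has the root 0, so the first argument of the average vanishes and
the second is 16ω. -/
lemma eval_neg_one_loopPoly (i j : ℕ) : (loopPoly i j).eval (-1) =
    ((i + j).choose i * (2 * i).choose i * (2 * j).choose j : ℕ) := by
  have hx : (MvPowerSeries.X 0 : Ser).constantCoeff = 0 := by simp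
  have hy : (MvPowerSeries.X 1 : Ser).constantCoeff = 0 := by simp
  have h1 := hasSum_halfPow_mul_arcsineSeries hx hy
  have h2 := hasSum_loopPoly_arcsineSeries 0 hx hy (map_zero _) rfl rfl rfl (by ring)
  have e1 : ∀ ω : Ser, 4 * 0 ^ 2 * ω + 0 + (16 * 0 * ω + 0) = 0 := fun ω => by ring
  have e2 : ∀ ω : Ser, 4 * (2 - 0) ^ 2 * ω + (16 * 0 * ω + 0) = 16 * ω := fun ω => by ring
  rw [e1, e2] at h2
  have h3 : ∀ L : ℤ[X], Polynomial.eval₂ (Int.castRingHom Ser) (0 - 1) L =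
      algebraMap ℚ Ser (L.eval (-1) : ℤ) := by
    intro L
    rw [Polynomial.eval_eq_sum_range, Polynomial.eval₂_eq_sum_range]
    simp
  simp only [h3, ← Algebra.smul_def] at h2
  have h4 := (coeff_of_hasSum_smul (r := fun p => (((loopPoly p.1 p.2).eval (-1) : ℤ) : ℚ)) h2 i j).symm.trans
    (coeff_of_hasSum_smul h1 i j)
  exact_mod_cast h4

lemma coeff_specialize_loopSeries (c : ℤ) (e : Fin 2 →₀ ℕ) :
    MvPowerSeries.coeff e (specialize c loopSeries) = (cornerPoly (e 0) (e 1) (0, 0)).eval c := rfl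

lemma hasSum_specialize_loopSeries (c : ℤ) (a : ℕ × ℕ → ℤ)
    (h : ∀ i j, (loopPoly i j).eval c = a (i, j)) :
    HasSum (fun p : ℕ × ℕ => (MvPowerSeries.C (a p) * MvPowerSeries.X 0 ^ (2 * p.1) *
      MvPowerSeries.X 1 ^ (2 * p.2) : MvPowerSeries (Fin 2) ℤ)) (specialize c loopSeries) := by
  refine MvPowerSeries.WithPiTopology.hasSum_iff_hasSum_coeff.mpr fun e => ?_
  have hc : ∀ p : ℕ × ℕ, MvPowerSeries.coeff e (MvPowerSeries.C (a p) *
      MvPowerSeries.X 0 ^ (2 * p.1) * MvPowerSeries.X 1 ^ (2 * p.2) : MvPowerSeries (Fin 2) ℤ) =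
      if e 0 = 2 * p.1 ∧ e 1 = 2 * p.2 then a p else 0 := by
    intro p
    rw [mul_assoc, MvPowerSeries.coeff_C_mul, MvPowerSeries.X_pow_eq, MvPowerSeries.X_pow_eq,
      MvPowerSeries.monomial_mul_monomial, MvPowerSeries.coeff_monomial]
    have : e = Finsupp.single 0 (2 * p.1) + Finsupp.single 1 (2 * p.2) ↔
        e 0 = 2 * p.1 ∧ e 1 = 2 * p.2 := by
      constructor
      · rintro rfl
        simp
      · rintro ⟨h, h2⟩
        ext m
        fin_cases m <;> simp_all
    simp only [this, mul_ite, mul_one, mul_zero]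
  simp only [hc, coeff_specialize_loopSeries]
  by_cases he : Even (e 0) ∧ Even (e 1)
  · obtain ⟨⟨i, hi⟩, ⟨j, hj⟩⟩ := he
    have h2 := hasSum_single (f := fun p : ℕ × ℕ => if e 0 = 2 * p.1 ∧ e 1 = 2 * p.2 then a p else 0)
      (i, j) fun p hp => if_neg fun hh => hp (Prod.ext (by simp; omega) (by simp; omega))
    rw [if_pos ⟨by simp; omega, by simp; omega⟩, ← h i j, loopPoly] at h2
    rwa [hi, hj, ← two_mul, ← two_mul] at h2 ⊢
  · rw [cornerPoly_eq_zero _ _ he, Polynomial.eval_zero]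
    refine hasSum_of_eq hasSum_zero fun p => (if_neg fun hh => he ?_).symm
    exact ⟨hh.1 ▸ even_two_mul _, hh.2 ▸ even_two_mul _⟩

lemma coeff_diagonal (F : MvPowerSeries (Fin 2) ℤ) (n : ℕ) :
    PowerSeries.coeff n (diagonal F) = ∑ p ∈ Finset.HasAntidiagonal.antidiagonal n,
      MvPowerSeries.coeff (Finsupp.single 0 p.1 + Finsupp.single 1 p.2) F := by
  have h : ∀ d : Fin 2 →₀ ℕ, (PowerSeries.coeff n)
      (d.prod fun _ e => (PowerSeries.X : PowerSeries ℤ) ^ e) = if d 0 + d 1 = n then 1 else 0 := by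
    intro d
    rw [Finsupp.prod_fintype _ _ (fun _ => pow_zero _), Fin.prod_univ_two, ← pow_add,
      PowerSeries.coeff_X_pow]
    simp only [eq_comm]
  have hs : MvPowerSeries.HasSubst (fun _ : Fin 2 => (PowerSeries.X : PowerSeries ℤ)) :=
    MvPowerSeries.hasSubst_of_constantCoeff_zero fun _ => PowerSeries.constantCoeff_X
  have h1 : PowerSeries.coeff n (diagonal F) = finsum fun d : Fin 2 →₀ ℕ =>
      MvPowerSeries.coeff d F • PowerSeries.coeff n
        (d.prod fun _ e => (PowerSeries.X : PowerSeries ℤ) ^ e) :=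
    MvPowerSeries.coeff_subst hs F _
  rw [h1]
  simp only [h]
  have hi : Function.Injective fun p : ℕ × ℕ =>
      (Finsupp.single 0 p.1 + Finsupp.single 1 p.2 : Fin 2 →₀ ℕ) := by
    intro p q hpq
    have e0 := DFunLike.congr_fun hpq 0
    have e1 := DFunLike.congr_fun hpq 1
    simp at e0 e1
    exact Prod.ext e0 e1
  rw [finsum_eq_sum_of_support_subset (s := (Finset.HasAntidiagonal.antidiagonal n).map ⟨_, hi⟩),
    Finset.sum_map]
  · refine Finset.sum_congr rfl fun p hp => ?_
    rw [Finset.HasAntidiagonal.mem_antidiagonal] at hp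
    simp [hp]
  · intro d hd
    have hd' : d 0 + d 1 = n := by
      by_contra hne
      exact hd (by simp [hne])
    simp only [Finset.coe_map, Set.mem_image, Finset.mem_coe,
      Finset.HasAntidiagonal.mem_antidiagonal]
    refine ⟨(d 0, d 1), hd', ?_⟩
    ext m
    fin_cases m <;> simp

/-- The sum of the squares of the n-th binomial row is the central binomial coefficient. -/
lemma sum_eval_one_loopPoly_eq (n : ℕ) : ∑ i ∈ Finset.range (n + 1),
    (loopPoly i (n - i)).eval 1 = ((2 * n).choose n ^ 2 : ℕ) := by
  have h := sum_choose_mul_choose n n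
  rw [min_self, ← two_mul] at h
  rw [Finset.sum_congr rfl fun i hi => eval_one_loopPoly_of_le
    (Nat.lt_succ_iff.mp (Finset.mem_range.mp hi)), ← Nat.cast_sum, ← Finset.mul_sum]
  simp only [pow_two, h]

lemma coeff_diagonal_specialize (c : ℤ) (n : ℕ) :
    PowerSeries.coeff n (diagonal (specialize c loopSeries)) =
      ∑ p ∈ Finset.HasAntidiagonal.antidiagonal n, (cornerPoly p.1 p.2 (0, 0)).eval c := by
  rw [coeff_diagonal]
  refine Finset.sum_congr rfl fun p _ => ?_
  rw [coeff_specialize_loopSeries]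
  simp

lemma hasSum_diagonal : HasSum (fun n : ℕ =>
        (PowerSeries.C (((2 * n).choose n ^ 2 : ℕ) : ℤ) * PowerSeries.X ^ (2 * n) :
          PowerSeries ℤ))
      (diagonal (specialize 1 loopSeries)) := by
  refine MvPowerSeries.WithPiTopology.hasSum_iff_hasSum_coeff.mpr fun e => ?_
  obtain ⟨n, rfl⟩ : ∃ n, e = Finsupp.single () n := ⟨e (), by ext; simp⟩
  change HasSum (fun k : ℕ => PowerSeries.coeff n
    (PowerSeries.C (((2 * k).choose k ^ 2 : ℕ) : ℤ) * PowerSeries.X ^ (2 * k)))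
    (PowerSeries.coeff n (diagonal (specialize 1 loopSeries)))
  simp only [PowerSeries.coeff_C_mul, PowerSeries.coeff_X_pow, mul_ite, mul_one, mul_zero]
  rw [coeff_diagonal_specialize, Finset.Nat.sum_antidiagonal_eq_sum_range_succ_mk]
  by_cases hn : Even n
  · obtain ⟨m, hm⟩ := hn
    have h1 := hasSum_single (f := fun k : ℕ => if n = 2 * k then
      (((2 * k).choose k ^ 2 : ℕ) : ℤ) else 0) m fun k hk => if_neg (by omega)
    rw [if_pos (by omega), ← sum_eval_one_loopPoly_eq] at h1
    convert h1 using 1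
    symm
    refine Finset.sum_of_injOn (fun i => 2 * i) ?_ ?_ ?_ ?_
    · intro i _ j _ hij
      simpa using hij
    · intro i hi
      simp only [Finset.coe_range, Set.mem_Iio] at hi ⊢
      omega
    · intro i hi hni
      rw [cornerPoly_eq_zero, Polynomial.eval_zero]
      rintro ⟨⟨k, hk⟩, -⟩
      simp only [Finset.mem_range] at hi
      exact hni ⟨k, by simp only [Finset.coe_range, Set.mem_Iio]; omega, by simp only; omega⟩
    · intro i hi
      simp only [Finset.mem_range] at hi
      simp only [loopPoly]
      rw [show n - 2 * i = 2 * (m - i) by omega]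
  · rw [Finset.sum_eq_zero fun i hi => ?_]
    · refine hasSum_of_eq hasSum_zero fun k => (if_neg ?_).symm
      rintro rfl
      exact hn (even_two_mul k)
    · rw [cornerPoly_eq_zero, Polynomial.eval_zero]
      rintro ⟨⟨k, hk⟩, ⟨l, hl⟩⟩
      simp only [Finset.mem_range] at hi hk hl
      exact hn ⟨k + l, by omega⟩

end Specialization
end SquareWalk

/-- The infinite sums converge in the product (coefficientwise) topology on power series,
`ℤ` being discrete. -/
theorem mainTheorem7 :
    SquareWalk.IsAddOnePositive SquareWalk.loopSeries ∧
    HasSum (fun p : ℕ × ℕ =>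
        (MvPowerSeries.C
            (((2 * p.1 + 2 * p.2).choose (2 * p.1) * (2 * p.1).choose p.1 *
              (2 * p.2).choose p.2 : ℕ) : ℤ) *
          MvPowerSeries.X 0 ^ (2 * p.1) * MvPowerSeries.X 1 ^ (2 * p.2) :
          MvPowerSeries (Fin 2) ℤ))
      (SquareWalk.specialize 1 SquareWalk.loopSeries) ∧
    HasSum (fun p : ℕ × ℕ =>
        (MvPowerSeries.C
            (((p.1 + p.2).choose p.1 * (2 * p.1).choose p.1 * (2 * p.2).choose p.2 : ℕ) : ℤ) *
          MvPowerSeries.X 0 ^ (2 * p.1) * MvPowerSeries.X 1 ^ (2 * p.2) :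
          MvPowerSeries (Fin 2) ℤ))
      (SquareWalk.specialize (-1) SquareWalk.loopSeries) ∧
    HasSum (fun n : ℕ =>
        (PowerSeries.C (((2 * n).choose n ^ 2 : ℕ) : ℤ) * PowerSeries.X ^ (2 * n) :
          PowerSeries ℤ))
      (SquareWalk.diagonal (SquareWalk.specialize 1 SquareWalk.loopSeries)) := by
  exact ⟨SquareWalk.isAddOnePositive_loopSeries,
    SquareWalk.hasSum_specialize_loopSeries 1 _ SquareWalk.eval_one_loopPoly,
    SquareWalk.hasSum_specialize_loopSeries (-1) _ SquareWalk.eval_neg_one_loopPoly,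
    SquareWalk.hasSum_diagonal⟩
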